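/- **Setting.** Let $X\subseteq\mathbb R^N$ be nonempty, compact and convex, let $Y\subseteq\mathbb R^N$ be bounded, $\|Y\|_1=\sup_{l\in Y}\|l\|_1$, and let $R:X\to\mathbb R$ be continuous and strictly convex, and $C^2$ with positive definite Hessian on a neighbourhood $U$ of the relative interior of $X$ (if $U\supseteq X$, the suprema over $X\cap U$ below are maxima over $X$). For $x\in X\cap U$ let $\|\cdot\|^*_{\nabla^2R(x)}$ be the dual of the norm $\|y\|_{\nabla^2 R(x)}=\sqrt{y^\top\nabla^2R(x)y}$. Let $T$ be the number of rounds, $k=\lceil\log_2T\rceil$ and $\varepsilon>0$. Let $\mathcal D=\mathrm{Lap}^N(\lambda)$ be the law of a vector in $\mathbb R^N$ with independent coordinates of Laplace law with scale $\lambda$ (the point mass at $0$ if $\lambda=0$), where $$\lambda=\frac{2\,\|Y\|_1\,\lceil\log_2T\rceil}{\varepsilon}.$$ **Algorithm** (learning rate $\eta>0$). Take the complete binary tree with $2^k$ leaves, numbered $1,\dots,2^k$. At every node put an independent sample from $\mathcal D$. After $t$ rounds a node is *populated* if all leaves below it have numbers at most $t$; its value is then the sum of the losses $l_s$ over the leaves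 $s$ below it plus its noise sample. Let $\mathcal S_t$ be the minimum set of populated nodes that covers the leaves $1,\dots,t$. Put $\tilde L_t$ equal to the sum of the values at the nodes of $\mathcal S_t$ plus $k-|\mathcal S_t|$ fresh independent samples from $\mathcal D$ (so $\tilde L_0$ is a sum of $k$ samples). In round $t=1,\dots,T$ the algorithm plays $$x_t=\arg\min_{x\in X}\big(\eta\langle x,\tilde L_{t-1}\rangle+R(x)\big)$$ and then sees $l_t\in Y$. **Theorem.** (Privacy) For every $\eta>0$ the algorithm is $\varepsilon$-differentially private: if $l,l'\in Y^T$ differ in at most one vector, the corresponding predictions satisfy $\mathbb P((x_t)_{t\le T}\in S)\le e^\varepsilon\,\mathbb P((x'_t)_{t\le T}\in S)$ for every measurable set $S$ of prediction sequences. (Regret) Let $l_1,\dots,l_T\in Y$ be fixed losses such that each $\sup_{x\in X\cap U}\|l_t\|^*_{\nabla^2R(x)}$ is finite, and put $$D_R=\max_XR-\min_XR,\qquad \Sigma=\sum_{t=1}^T\sup_{x\in X\cap U}\big(\|l_t\|^*_{\nabla^2R(x)}\big)^2,\qquad D_{Lap}=\mathbb E_{Z\sim\mathcal D'}\Big[\max_{x\in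 X}\langle Z,x\rangle-\min_{x\in X}\langle Z,x\rangle\Big],$$ where $\mathcal D'$ is the law of the sum of $k$ independent samples from $\mathcal D$. These expectations exist, and for every $\eta>0$ $$\mathrm{Regret}=\mathbb E\Big[\sum_{t=1}^T\langle l_t,x_t\rangle-\min_{x\in X}\sum_{t=1}^T\langle l_t,x\rangle\Big]\le\frac{D_R}{\eta}+\frac{\eta}{2}\,\Sigma+D_{Lap}.$$ In particular, with $\eta=\sqrt{2D_R/\Sigma}$ (any $\eta>0$ if $D_R\,\Sigma=0$), $$\mathrm{Regret}\le\sqrt{2\,D_R\sum_{t=1}^T\sup_{x\in X\cap U}\big(\|l_t\|^*_{\nabla^2R(x)}\big)^2}+D_{Lap}.$$ -/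

import Mathlib

open MeasureTheory

noncomputable section

namespace DPFTRL

/-! ### Laplace noise -/

/-- The Laplace distribution on `ℝ` with scale `b`, density `exp (-|x| / b) / (2 b)`;
for `b = 0` it is the point mass at `0`. -/
def laplace (b : ℝ) : Measure ℝ :=
  if b = 0 then Measure.dirac 0
  else volume.withDensity (fun x => ENNReal.ofReal (Real.exp (-|x| / b) / (2 * b)))

/-- `Lap^N(b)`: independent Laplace coordinates with scale `b`. -/
def laplaceVec (N : ℕ) (b : ℝ) : Measure (EuclideanSpace ℝ (Fin N)) :=
  (Measure.pi (fun _ : Fin N => laplace b)).map (WithLp.toLp 2)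

/-- The law of the sum of `k` independent samples from `D`. -/
def sumLaw {N : ℕ} (k : ℕ) (D : Measure (EuclideanSpace ℝ (Fin N))) :
    Measure (EuclideanSpace ℝ (Fin N)) :=
  (Measure.pi (fun _ : Fin k => D)).map (fun z => ∑ i, z i)

/-! ### The binary tree

Rounds are numbered `0, …, T - 1`, so the losses known after `t` rounds are those with index
in `{0, …, t - 1}`. -/

/-- Depth of the tree: `⌈log₂ T⌉`. -/
def depth (T : ℕ) : ℕ := Nat.clog 2 T

/-- Nodes of the complete binary tree with `2 ^ depth T` leaves: at level `m` (leaves are at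
level `0`) there are `2 ^ (depth T - m)` nodes. -/
abbrev TreeNode (T : ℕ) : Type :=
  Σ m : Fin (depth T + 1), Fin (2 ^ (depth T - (m : ℕ)))

/-- The leaves below a node: node `j` of level `m` covers `[j 2^m, (j+1) 2^m)`. -/
def leaves {T : ℕ} (v : TreeNode T) : Finset ℕ :=
  Finset.Ico ((v.2 : ℕ) * 2 ^ (v.1 : ℕ)) (((v.2 : ℕ) + 1) * 2 ^ (v.1 : ℕ))

/-- After `t` rounds a node is populated when all leaves below it have been filled. -/
def Populated {T : ℕ} (t : ℕ) (v : TreeNode T) : Prop := ∀ s ∈ leaves v, s < t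

open Classical in
/-- The minimum set of populated nodes from which the sum of the first `t` losses can be
computed. It consists of the populated nodes that lie below no other populated node; the lemmas
`prefixNodes_disjoint`, `prefixNodes_cover` and `prefixNodes_card_le` show that it has the
required properties. -/
def prefixNodes (T t : ℕ) : Finset (TreeNode T) :=
  Finset.univ.filter
    (fun v => Populated t v ∧ ∀ u : TreeNode T, Populated t u → leaves v ⊆ leaves u → u = v)

theorem mem_leaves {T : ℕ} (v : TreeNode T) (s : ℕ) :
    s ∈ leaves v ↔ s / 2 ^ (v.1 : ℕ) = (v.2 : ℕ) := by
  have hp : 0 < 2 ^ (v.1 : ℕ) := by positivity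
  rw [leaves, Finset.mem_Ico, Nat.div_eq_iff hp]
  have : ((v.2 : ℕ) + 1) * 2 ^ (v.1 : ℕ) = (v.2 : ℕ) * 2 ^ (v.1 : ℕ) + 2 ^ (v.1 : ℕ) := by ring
  omega

theorem leaves_subset {T : ℕ} {u v : TreeNode T} {s : ℕ} (hu : s ∈ leaves u) (hv : s ∈ leaves v)
    (h : (v.1 : ℕ) ≤ (u.1 : ℕ)) : leaves v ⊆ leaves u := by
  intro s' hs'
  rw [mem_leaves] at *
  obtain ⟨d, hd⟩ := Nat.exists_eq_add_of_le h
  have key : ∀ a : ℕ, a / 2 ^ (u.1 : ℕ) = a / 2 ^ (v.1 : ℕ) / 2 ^ d := by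
    intro a
    rw [Nat.div_div_eq_div_mul, ← pow_add, ← hd]
  rw [key, hs', ← hv, ← key, hu]

theorem eq_of_level_eq {T : ℕ} {u v : TreeNode T} {s : ℕ} (hu : s ∈ leaves u)
    (hv : s ∈ leaves v) (h : (v.1 : ℕ) = (u.1 : ℕ)) : u = v := by
  rw [mem_leaves] at hu hv
  obtain ⟨m, j⟩ := u
  obtain ⟨m', j'⟩ := v
  obtain rfl : m' = m := Fin.ext h
  congr 1
  exact Fin.ext (hu.symm.trans hv)

theorem populated_of_mem_prefixNodes {T t : ℕ} {v : TreeNode T} (hv : v ∈ prefixNodes T t) :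
    Populated t v := by
  classical
  exact (Finset.mem_filter.mp hv).2.1

/-- Different nodes of the set have disjoint sets of leaves. -/
theorem prefixNodes_disjoint {T t : ℕ} {u v : TreeNode T} (hu : u ∈ prefixNodes T t)
    (hv : v ∈ prefixNodes T t) (huv : u ≠ v) : Disjoint (leaves u) (leaves v) := by
  classical
  rw [Finset.disjoint_left]
  intro s hsu hsv
  have hu' := (Finset.mem_filter.mp hu).2
  have hv' := (Finset.mem_filter.mp hv).2
  rcases le_total (v.1 : ℕ) (u.1 : ℕ) with h | h
  · exact huv (hv'.2 u hu'.1 (leaves_subset hsu hsv h))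
  · exact huv (hu'.2 v hv'.1 (leaves_subset hsv hsu h)).symm

/-- The nodes of the set cover exactly the first `t` leaves. -/
theorem prefixNodes_cover {T t : ℕ} (ht : t ≤ T) (s : ℕ) :
    (∃ v ∈ prefixNodes T t, s ∈ leaves v) ↔ s < t := by
  classical
  constructor
  · rintro ⟨v, hv, hs⟩
    exact populated_of_mem_prefixNodes hv s hs
  · intro hs
    have hsT : s < 2 ^ depth T :=
      lt_of_lt_of_le (lt_of_lt_of_le hs ht) (Nat.le_pow_clog one_lt_two T)
    let leaf : TreeNode T := ⟨⟨0, Nat.succ_pos _⟩, ⟨s, by simpa using hsT⟩⟩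
    have hleaf : s ∈ leaves leaf := by
      rw [mem_leaves]
      simp [leaf]
    have hpop : Populated t leaf := by
      intro s' hs'
      rw [mem_leaves] at hs'
      have : s' = s := by simpa [leaf] using hs'
      omega
    obtain ⟨v, hv, hmax⟩ := Finset.exists_max_image
      ((Finset.univ : Finset (TreeNode T)).filter (fun v => Populated t v ∧ s ∈ leaves v))
      (fun v => (v.1 : ℕ)) ⟨leaf, by simp [hpop, hleaf]⟩
    have hv' := (Finset.mem_filter.mp hv).2
    refine ⟨v, Finset.mem_filter.mpr ⟨Finset.mem_univ _, hv'.1, ?_⟩, hv'.2⟩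
    intro u hu hsub
    have hle := hmax u (by simp [hu, hsub hv'.2])
    have hge : leaves u ⊆ leaves v := leaves_subset hv'.2 (hsub hv'.2) hle
    have hcard := congrArg Finset.card (Finset.Subset.antisymm hge hsub)
    have hc : ∀ w : TreeNode T, (leaves w).card = 2 ^ (w.1 : ℕ) := by
      intro w
      rw [leaves, Nat.card_Ico, add_mul, one_mul, Nat.add_sub_cancel_left]
    rw [hc, hc] at hcard
    exact eq_of_level_eq (hsub hv'.2) hv'.2 (Nat.pow_right_injective le_rfl hcard).symm

/-- No set of populated nodes that covers the first `t` leaves is smaller. -/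
theorem prefixNodes_card_le {T t : ℕ} (C : Finset (TreeNode T))
    (hC : ∀ u ∈ C, Populated t u) (hcov : ∀ s, s < t → ∃ u ∈ C, s ∈ leaves u) :
    (prefixNodes T t).card ≤ C.card := by
  classical
  have key : ∀ v ∈ prefixNodes T t, ∃ u ∈ C, leaves u ⊆ leaves v ∧ (leaves u).Nonempty := by
    intro v hv
    have hv' := (Finset.mem_filter.mp hv).2
    have hmem : (v.2 : ℕ) * 2 ^ (v.1 : ℕ) ∈ leaves v := by
      rw [mem_leaves]
      exact Nat.mul_div_cancel _ (by positivity)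
    obtain ⟨u, hu, hsu⟩ := hcov _ (hv'.1 _ hmem)
    refine ⟨u, hu, ?_, ⟨_, hsu⟩⟩
    rcases le_total (v.1 : ℕ) (u.1 : ℕ) with h | h
    · rw [hv'.2 u (hC u hu) (leaves_subset hsu hmem h)]
    · exact leaves_subset hmem hsu h
  choose! f hf using key
  refine Finset.card_le_card_of_injOn f (fun v hv => (hf v hv).1) ?_
  intro v hv w hw hvw
  by_contra hne
  obtain ⟨s, hs⟩ := (hf v hv).2.2
  have h2 : s ∈ leaves (f w) := by rw [← hvw]; exact hs
  exact Finset.disjoint_left.mp (prefixNodes_disjoint hv hw hne)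
    ((hf v hv).2.1 hs) ((hf w hw).2.1 h2)

/-- Indices of all noise vectors: one per tree node, and the extra vectors `n_t^i`,
`0 ≤ t ≤ T`, `i < ⌈log₂ T⌉` (of which only the first `r_t` are used at time `t`). -/
abbrev NoiseIndex (T : ℕ) : Type := TreeNode T ⊕ (Fin (T + 1) × Fin (depth T))

/-- A realisation of all noise vectors. -/
abbrev Noise (N T : ℕ) : Type := NoiseIndex T → EuclideanSpace ℝ (Fin N)

/-- All noise vectors are independent samples from `D`. -/
def noiseLaw {N : ℕ} (T : ℕ) (D : Measure (EuclideanSpace ℝ (Fin N))) : Measure (Noise N T) :=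
  Measure.pi (fun _ => D)

/-- The value stored at a populated node: the sum of the losses below it plus the noise of the
node. -/
def nodeValue {N T : ℕ} (l : Fin T → EuclideanSpace ℝ (Fin N)) (ω : Noise N T)
    (v : TreeNode T) : EuclideanSpace ℝ (Fin N) :=
  (∑ s ∈ Finset.univ.filter (fun s : Fin T => (s : ℕ) ∈ leaves v), l s) + ω (Sum.inl v)

/-- The estimate `L̃_t` of the sum of the first `t` losses: the sum of the noisy values on the
minimum set `S` of populated nodes plus `r_t = ⌈log₂ T⌉ - |S|` further independent samples.
For `t = 0` this is the sum of `⌈log₂ T⌉` samples. -/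
def prefixEstimate {N T : ℕ} (l : Fin T → EuclideanSpace ℝ (Fin N)) (ω : Noise N T)
    (t : Fin (T + 1)) : EuclideanSpace ℝ (Fin N) :=
  (∑ v ∈ prefixNodes T t, nodeValue l ω v) +
    ∑ i ∈ Finset.univ.filter
      (fun i : Fin (depth T) => (i : ℕ) < depth T - (prefixNodes T t).card), ω (Sum.inr (t, i))

/-! ### Follow the regularized leader -/

/-- A minimiser of `η ⟨x, L⟩ + R x` over `x ∈ X`. -/
def regArgmin {N : ℕ} (X : Set (EuclideanSpace ℝ (Fin N))) (R : EuclideanSpace ℝ (Fin N) → ℝ)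
    (η : ℝ) (L : EuclideanSpace ℝ (Fin N)) : EuclideanSpace ℝ (Fin N) :=
  Classical.epsilon (fun x => x ∈ X ∧ IsMinOn (fun y => η * inner ℝ y L + R y) X x)

/-- The predictions of the algorithm on the loss sequence `l` and the noise realisation `ω`.
The prediction of round `t` uses the estimate of the sum of the losses of the rounds before. -/
def predictions {N T : ℕ} (X : Set (EuclideanSpace ℝ (Fin N)))
    (R : EuclideanSpace ℝ (Fin N) → ℝ) (η : ℝ)
    (l : Fin T → EuclideanSpace ℝ (Fin N)) (ω : Noise N T) (t : Fin T) :
    EuclideanSpace ℝ (Fin N) :=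
  regArgmin X R η (prefixEstimate l ω t.castSucc)

/-- The realised regret of a sequence of predictions against the best fixed point of `X`. -/
def realizedRegret {N T : ℕ} (X : Set (EuclideanSpace ℝ (Fin N)))
    (l x : Fin T → EuclideanSpace ℝ (Fin N)) : ℝ :=
  ∑ t, inner ℝ (l t) (x t) - sInf ((fun u => ∑ t, inner ℝ (l t) u) '' X)

/-- `(ε, δ)`-differential privacy of a randomized map `A` from loss sequences to sequences of
predictions, with randomness `ω` distributed according to `P`. -/
def IsDifferentiallyPrivate {N T : ℕ} {Ω : Type*} [MeasurableSpace Ω] (P : Measure Ω)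
    (A : (Fin T → EuclideanSpace ℝ (Fin N)) → Ω → Fin T → EuclideanSpace ℝ (Fin N))
    (Y : Set (EuclideanSpace ℝ (Fin N))) (ε δ : ℝ) : Prop :=
  ∀ l l' : Fin T → EuclideanSpace ℝ (Fin N), (∀ t, l t ∈ Y) → (∀ t, l' t ∈ Y) →
    (∃ t₀, ∀ t, t ≠ t₀ → l t = l' t) →
    ∀ S : Set (Fin T → EuclideanSpace ℝ (Fin N)), MeasurableSet S →
      P {ω | A l ω ∈ S} ≤ ENNReal.ofReal (Real.exp ε) * P {ω | A l' ω ∈ S} + ENNReal.ofReal δ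

/-! ### The quantities in the bounds -/

/-- `‖Y‖₁`, the supremum of the `ℓ¹` norm over `Y`. -/
def l1Radius {N : ℕ} (Y : Set (EuclideanSpace ℝ (Fin N))) : ℝ :=
  sSup ((fun l => ∑ i, |l i|) '' Y)

/-- The norm `‖y‖ = √(yᵀ ∇²R(x) y)`. -/
def hessNorm {N : ℕ} (R : EuclideanSpace ℝ (Fin N) → ℝ) (x y : EuclideanSpace ℝ (Fin N)) : ℝ :=
  √(fderiv ℝ (fderiv ℝ R) x y y)

/-- The dual norm of `hessNorm R x`. -/
def dualHessNorm {N : ℕ} (R : EuclideanSpace ℝ (Fin N) → ℝ)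
    (x l : EuclideanSpace ℝ (Fin N)) : ℝ :=
  sSup ((fun y => inner ℝ l y) '' {y | hessNorm R x y ≤ 1})

/-- The sum over the rounds of the supremum over `x ∈ V` of the squared dual local norm of the
loss. -/
def sumSqDual {N T : ℕ} (R : EuclideanSpace ℝ (Fin N) → ℝ) (V : Set (EuclideanSpace ℝ (Fin N)))
    (l : Fin T → EuclideanSpace ℝ (Fin N)) : ℝ :=
  ∑ t, sSup ((fun x => dualHessNorm R x (l t) ^ 2) '' V)

/-- `D_R`, the range of the regularizer on `X`. -/
def regRange {N : ℕ} (X : Set (EuclideanSpace ℝ (Fin N)))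
    (R : EuclideanSpace ℝ (Fin N) → ℝ) : ℝ :=
  sSup (R '' X) - sInf (R '' X)

/-- The width of `X` in the direction `z`. -/
def width {N : ℕ} (X : Set (EuclideanSpace ℝ (Fin N))) (z : EuclideanSpace ℝ (Fin N)) : ℝ :=
  sSup ((fun x => inner ℝ z x) '' X) - sInf ((fun x => inner ℝ z x) '' X)

end DPFTRL

end

open DPFTRL

noncomputable section

namespace DPFTRL

open ProbabilityTheory Filter Topology

/-! ### Product measures -/

/-! Privacy is a translation argument. Changing one loss affects only the tree nodes above its leaf,
one per level, and the root is never read because a prediction uses fewer than `2 ^ depth T` losses.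
Shifting the noise at the remaining `depth T` nodes by the change in the loss makes the two runs
agree pointwise (`prefixEstimate_add_noiseShift`). The total ℓ¹ length of the shift is at most `2 *
l1Radius Y * depth T` (`sum_l1_noiseShift_le`), and for positive scale a shift of product Laplace
noise costs a factor exp(length / scale).

For the regret, padding makes every estimate the exact prefix sum plus `depth T` distinct noise
vectors (`exists_injective_prefixEstimate_eq`). Expected regret is a sum over rounds, so only the
law of each estimate matters, and one perturbation `z` may be shared by all rounds
(`integral_realizedRegret_predictions`). For fixed `z` this is follow the regularized leader with
regularizer R + η⟨z, ·⟩, whose range is at most `regRange X R + η * width X z`; a telescoping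
argument (`ftrl_sum_le`) reduces its regret to the stability estimate `inner_sub_le_of_isMinOn`.
Stability needs strong convexity only along one segment, with modulus ⟨l, y - x⟩² / M
(`regularizer_strong_convexity`), which follows from Cauchy–Schwarz for the local norm and its dual.
-/

theorem pi_le_smul_pi {ι : Type*} [Fintype ι] {α : ι → Type*} [∀ i, MeasurableSpace (α i)]
    (μ ν : ∀ i, Measure (α i)) (c : ι → ENNReal) (hc0 : ∀ i, c i ≠ 0) (hc : ∀ i, c i ≠ ⊤)
    (h : ∀ i, μ i ≤ c i • ν i) : Measure.pi μ ≤ (∏ i, c i) • Measure.pi ν := by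
  have hC0 : ∏ i, c i ≠ 0 := Finset.prod_ne_zero_iff.mpr fun i _ => hc0 i
  have hC : ∏ i, c i ≠ ⊤ := ENNReal.prod_ne_top fun i _ => hc i
  -- The product outer measure is the largest one bounded by the product on boxes, so a comparison
  -- on boxes suffices.
  have key : (∏ i, c i)⁻¹ • OuterMeasure.pi (fun i => (μ i).toOuterMeasure) ≤
      OuterMeasure.pi (fun i => (ν i).toOuterMeasure) := by
    rw [OuterMeasure.le_pi]
    intro s _
    rw [smul_apply, smul_eq_mul]
    calc (∏ i, c i)⁻¹ * OuterMeasure.pi (fun i => (μ i).toOuterMeasure) (Set.univ.pi s)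
        ≤ (∏ i, c i)⁻¹ * ∏ i, (μ i) (s i) := by
          gcongr
          exact OuterMeasure.pi_pi_le _ _
      _ ≤ (∏ i, c i)⁻¹ * ∏ i, (c i * (ν i) (s i)) := by
          gcongr with i
          exact h i (s i)
      _ = ∏ i, (ν i) (s i) := by
          rw [Finset.prod_mul_distrib, ← mul_assoc, ENNReal.inv_mul_cancel hC0 hC, one_mul]
  refine Measure.le_iff.mpr fun s hs => ?_
  have hk := key s
  rw [smul_apply, smul_eq_mul] at hk
  rw [Measure.smul_apply, smul_eq_mul, Measure.pi, Measure.pi, toMeasure_apply _ _ hs,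
    toMeasure_apply _ _ hs]
  calc _ = (∏ i, c i) * ((∏ i, c i)⁻¹ * OuterMeasure.pi (fun i => (μ i).toOuterMeasure) s) := by
        rw [← mul_assoc, ENNReal.mul_inv_cancel hC0 hC, one_mul]
    _ ≤ _ := by gcongr

theorem map_pi_le_smul_pi {ι : Type*} [Fintype ι] {α : ι → Type*} [∀ i, MeasurableSpace (α i)]
    (μ : ∀ i, Measure (α i)) [∀ i, IsProbabilityMeasure (μ i)] (f : ∀ i, α i → α i)
    (hf : ∀ i, Measurable (f i)) (c : ι → ENNReal) (hc0 : ∀ i, c i ≠ 0) (hc : ∀ i, c i ≠ ⊤)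
    (h : ∀ i, (μ i).map (f i) ≤ c i • μ i) :
    (Measure.pi μ).map (fun x i => f i (x i)) ≤ (∏ i, c i) • Measure.pi μ := by
  have : ∀ i, IsProbabilityMeasure ((μ i).map (f i)) := fun i =>
    Measure.isProbabilityMeasure_map (hf i).aemeasurable
  rw [Measure.pi_map_pi (fun i => (hf i).aemeasurable)]
  exact pi_le_smul_pi _ _ c hc0 hc h

theorem map_pi_comp_injective {ι κ Ω : Type*} [Fintype ι] [Fintype κ] [MeasurableSpace Ω]
    (D : Measure Ω) [IsProbabilityMeasure D] (e : κ → ι) (he : Function.Injective e) :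
    (Measure.pi (fun _ : ι => D)).map (fun ω i => ω (e i)) = Measure.pi (fun _ : κ => D) := by
  have h := (iIndepFun_pi (μ := fun _ : ι => D) (X := fun _ => id)
    (fun _ => aemeasurable_id)).precomp he
  have h2 : (Measure.pi (fun _ : ι => D)).map (fun ω i => ω (e i)) =
      Measure.pi (fun i => (Measure.pi (fun _ : ι => D)).map (fun ω => ω (e i))) :=
    (iIndepFun_iff_map_fun_eq_pi_map
      (fun i => (measurable_pi_apply (e i)).aemeasurable)).mp h
  rw [h2]
  congr 1
  funext i
  exact (measurePreserving_eval (fun _ : ι => D) (e i)).map_eq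

/-! ### The Laplace distribution -/

theorem integral_exp_neg_abs_div {b : ℝ} (hb : 0 < b) : ∫ x : ℝ, Real.exp (-|x| / b) = 2 * b := by
  rw [integral_comp_abs (f := fun x => Real.exp (-x / b))]
  have : ∀ x : ℝ, -x / b = (-(1 / b)) * x := fun x => by ring
  simp_rw [this]
  rw [integral_exp_mul_Ioi (by simpa using hb)]
  simp

theorem integrable_exp_neg_abs_div {b : ℝ} (hb : 0 < b) :
    Integrable (fun x : ℝ => Real.exp (-|x| / b)) := by
  by_contra h
  have := integral_exp_neg_abs_div hb
  rw [integral_undef h] at this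
  linarith

theorem isProbabilityMeasure_laplace {b : ℝ} (hb : 0 ≤ b) : IsProbabilityMeasure (laplace b) := by
  rcases hb.eq_or_lt with rfl | hb
  · rw [laplace, if_pos rfl]
    infer_instance
  · rw [laplace, if_neg hb.ne']
    constructor
    rw [withDensity_apply _ MeasurableSet.univ, Measure.restrict_univ,
      ← ofReal_integral_eq_lintegral_ofReal ((integrable_exp_neg_abs_div hb).div_const _)
        (Filter.Eventually.of_forall fun x => by positivity),
      integral_div, integral_exp_neg_abs_div hb, div_self (by positivity), ENNReal.ofReal_one]

theorem integrable_abs_laplace {b : ℝ} (hb : 0 ≤ b) :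
    Integrable (fun x : ℝ => |x|) (laplace b) := by
  rcases hb.eq_or_lt with rfl | hb
  · rw [laplace, if_pos rfl]
    exact integrable_dirac (by simp)
  · rw [laplace, if_neg hb.ne', integrable_withDensity_iff (by fun_prop)
      (Filter.Eventually.of_forall fun x => ENNReal.ofReal_lt_top)]
    -- Half of the exponential decay absorbs the factor |x| / (2b), through u ≤ exp u.
    refine (integrable_exp_neg_abs_div (b := 2 * b) (by positivity)).mono'
      (by fun_prop) (Filter.Eventually.of_forall fun x => ?_)
    rw [ENNReal.toReal_ofReal (by positivity), Real.norm_of_nonneg (by positivity)]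
    have h1 : |x| / (2 * b) ≤ Real.exp (|x| / (2 * b)) := by
      linarith [Real.add_one_le_exp (|x| / (2 * b))]
    calc |x| * (Real.exp (-|x| / b) / (2 * b)) = |x| / (2 * b) * Real.exp (-|x| / b) := by ring
      _ ≤ Real.exp (|x| / (2 * b)) * Real.exp (-|x| / b) := by gcongr
      _ = Real.exp (-|x| / (2 * b)) := by
        rw [← Real.exp_add]
        congr 1
        field_simp
        ring

/-- By the triangle inequality the density at x is at most exp(|a| / b) times the density at x + a.
Translation invariance of Lebesgue measure brings both integrals to this form. -/
theorem map_add_laplace_le {b : ℝ} (hb : 0 < b) (a : ℝ) :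
    (laplace b).map (· + a) ≤ ENNReal.ofReal (Real.exp (|a| / b)) • laplace b := by
  refine Measure.le_iff.mpr fun s hs => ?_
  set f : ℝ → ENNReal := fun x => ENNReal.ofReal (Real.exp (-|x| / b) / (2 * b)) with hf
  have hfm : Measurable f := by fun_prop
  rw [Measure.map_apply (by fun_prop) hs, laplace, if_neg hb.ne', Measure.smul_apply, smul_eq_mul,
    withDensity_apply _ hs, withDensity_apply _ ((measurable_add_const a) hs),
    ← lintegral_indicator hs, ← lintegral_indicator ((measurable_add_const a) hs),
    ← lintegral_const_mul _ (hfm.indicator hs),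
    ← lintegral_add_right_eq_self (fun x => ENNReal.ofReal (Real.exp (|a| / b)) *
      s.indicator f x) a]
  refine lintegral_mono fun x => ?_
  by_cases hx : x + a ∈ s
  · rw [Set.indicator_of_mem (show x ∈ (· + a) ⁻¹' s from hx), Set.indicator_of_mem hx, hf,
      ← ENNReal.ofReal_mul (by positivity)]
    apply ENNReal.ofReal_le_ofReal
    rw [← mul_div_assoc, ← Real.exp_add]
    gcongr
    rw [← add_div]
    gcongr
    linarith [abs_add_le x a]
  · rw [Set.indicator_of_notMem (show x ∉ (· + a) ⁻¹' s from hx)]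
    exact zero_le

variable {N : ℕ}

theorem isProbabilityMeasure_laplaceVec {b : ℝ} (hb : 0 ≤ b) :
    IsProbabilityMeasure (laplaceVec N b) := by
  have := isProbabilityMeasure_laplace hb
  exact Measure.isProbabilityMeasure_map (by fun_prop)

theorem map_add_laplaceVec_le {b : ℝ} (hb : 0 < b) (w : EuclideanSpace ℝ (Fin N)) :
    (laplaceVec N b).map (· + w) ≤
      ENNReal.ofReal (Real.exp ((∑ i, |w i|) / b)) • laplaceVec N b := by
  have := isProbabilityMeasure_laplace hb.le
  have h := map_pi_le_smul_pi (fun _ : Fin N => laplace b) (fun i x => x + w i)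
    (fun i => by fun_prop) (fun i => ENNReal.ofReal (Real.exp (|w i| / b)))
    (fun i => by simp [Real.exp_pos]) (fun i => ENNReal.ofReal_ne_top)
    (fun i => map_add_laplace_le hb (w i))
  rw [← ENNReal.ofReal_prod_of_nonneg (fun i _ => (Real.exp_pos _).le), ← Real.exp_sum,
    ← Finset.sum_div] at h
  have h2 := Measure.map_mono h (f := WithLp.toLp 2) (by fun_prop)
  rw [Measure.map_smul, Measure.map_map (by fun_prop) (by fun_prop)] at h2
  rw [laplaceVec, Measure.map_map (by fun_prop) (by fun_prop)]
  exact h2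

theorem integrable_norm_laplaceVec {b : ℝ} (hb : 0 ≤ b) :
    Integrable (fun z => ‖z‖) (laplaceVec N b) := by
  have := isProbabilityMeasure_laplace hb
  rw [laplaceVec, integrable_map_measure (by fun_prop) (by fun_prop)]
  have h : Integrable (fun x : Fin N → ℝ => ∑ i, |x i|)
      (Measure.pi (fun _ : Fin N => laplace b)) :=
    integrable_finsetSum _ fun i _ =>
      integrable_comp_eval (μ := fun _ : Fin N => laplace b) (i := i) (f := fun x => |x|)
        (integrable_abs_laplace hb)
  refine h.mono' (by fun_prop) (Filter.Eventually.of_forall fun x => ?_)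
  simp only [Function.comp, norm_norm]
  rw [EuclideanSpace.norm_eq]
  refine Real.sqrt_le_iff.mpr ⟨by positivity, ?_⟩
  simpa using Finset.sum_sq_le_sq_sum_of_nonneg (s := Finset.univ)
    (f := fun i => |x i|) (fun i _ => abs_nonneg _)

theorem isProbabilityMeasure_sumLaw (k : ℕ) (D : Measure (EuclideanSpace ℝ (Fin N)))
    [IsProbabilityMeasure D] : IsProbabilityMeasure (sumLaw k D) :=
  Measure.isProbabilityMeasure_map (by fun_prop)

theorem integrable_norm_sumLaw (k : ℕ) (D : Measure (EuclideanSpace ℝ (Fin N)))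
    [IsProbabilityMeasure D] (hD : Integrable (fun z => ‖z‖) D) :
    Integrable (fun z => ‖z‖) (sumLaw k D) := by
  rw [sumLaw, integrable_map_measure (by fun_prop) (by fun_prop)]
  have h : Integrable (fun x : Fin k → EuclideanSpace ℝ (Fin N) => ∑ i, ‖x i‖)
      (Measure.pi (fun _ : Fin k => D)) :=
    integrable_finsetSum _ fun i _ =>
      integrable_comp_eval (μ := fun _ : Fin k => D) (i := i) (f := fun x => ‖x‖) hD
  refine h.mono' (by fun_prop) (Filter.Eventually.of_forall fun x => ?_)
  simp only [Function.comp, norm_norm]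
  exact norm_sum_le _ _

/-! ### The dyadic decomposition of a prefix -/

variable {T : ℕ}

/-- The root has too many leaves to be populated. For node j of level m, being populated gives (j +
1)2^m ≤ t, and maximality leaves the parent unpopulated, so t < 2(⌊j/2⌋ + 1)2^m. These bounds
determine j from m and t, so each level contributes at most one node. -/
theorem index_of_mem_prefixNodes {t : ℕ} (ht : t < 2 ^ depth T) {v : TreeNode T}
    (hv : v ∈ prefixNodes T t) : (v.1 : ℕ) < depth T ∧ (v.2 : ℕ) + 1 = t / 2 ^ (v.1 : ℕ) := by
  classical
  have hpop := populated_of_mem_prefixNodes hv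
  have hmax := (Finset.mem_filter.mp hv).2.2
  have hp : 0 < 2 ^ (v.1 : ℕ) := by positivity
  have hle : ((v.2 : ℕ) + 1) * 2 ^ (v.1 : ℕ) ≤ t := by
    have hexp : ((v.2 : ℕ) + 1) * 2 ^ (v.1 : ℕ) = (v.2 : ℕ) * 2 ^ (v.1 : ℕ) + 2 ^ (v.1 : ℕ) := by
      ring
    have := hpop (((v.2 : ℕ) + 1) * 2 ^ (v.1 : ℕ) - 1) (by
      rw [leaves, Finset.mem_Ico]
      omega)
    omega
  have hlt : (v.1 : ℕ) < depth T := by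
    refine lt_of_le_of_ne (Nat.lt_succ_iff.mp v.1.2) fun h => ?_
    have hle' : 2 ^ (v.1 : ℕ) ≤ t := (Nat.le_mul_of_pos_left _ (Nat.succ_pos _)).trans hle
    rw [h] at hle'
    omega
  refine ⟨hlt, le_antisymm ((Nat.le_div_iff_mul_le hp).mpr hle) ?_⟩
  have hj : (v.2 : ℕ) / 2 < 2 ^ (depth T - ((v.1 : ℕ) + 1)) := by
    rw [Nat.div_lt_iff_lt_mul two_pos, ← pow_succ,
      show depth T - ((v.1 : ℕ) + 1) + 1 = depth T - (v.1 : ℕ) by omega]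
    exact v.2.2
  -- The parent of `v`.
  let u : TreeNode T := ⟨⟨(v.1 : ℕ) + 1, by omega⟩, ⟨(v.2 : ℕ) / 2, hj⟩⟩
  have hvu : leaves v ⊆ leaves u := by
    have hmem : (v.2 : ℕ) * 2 ^ (v.1 : ℕ) ∈ leaves v := by
      rw [mem_leaves]
      exact Nat.mul_div_cancel _ hp
    refine leaves_subset (s := (v.2 : ℕ) * 2 ^ (v.1 : ℕ)) ?_ hmem (Nat.le_succ _)
    rw [mem_leaves]
    change (v.2 : ℕ) * 2 ^ (v.1 : ℕ) / 2 ^ ((v.1 : ℕ) + 1) = (v.2 : ℕ) / 2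
    rw [pow_succ, ← Nat.div_div_eq_div_mul, Nat.mul_div_cancel _ hp]
  have hnot : ¬ Populated t u := fun hu => by
    have h := congrArg (fun w : TreeNode T => (w.1 : ℕ)) (hmax u hu hvu)
    simp [u] at h
  obtain ⟨s, hs, hts⟩ : ∃ s ∈ leaves u, t ≤ s := by
    simpa [Populated] using hnot
  rw [leaves, Finset.mem_Ico] at hs
  have h2 : t < (((v.2 : ℕ) / 2 + 1) * 2) * 2 ^ (v.1 : ℕ) := by
    refine lt_of_le_of_lt hts (lt_of_lt_of_eq hs.2 ?_)
    change ((v.2 : ℕ) / 2 + 1) * 2 ^ ((v.1 : ℕ) + 1) = _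
    ring
  have h3 := (Nat.div_lt_iff_lt_mul hp).mpr h2
  omega

/-- This makes the natural-number subtraction in the padding of `prefixEstimate` exact. -/
theorem card_prefixNodes_le_depth {t : ℕ} (ht : t < 2 ^ depth T) :
    (prefixNodes T t).card ≤ depth T := by
  rw [← Finset.card_range (depth T)]
  refine Finset.card_le_card_of_injOn (fun v => (v.1 : ℕ))
    (fun v hv => Finset.mem_coe.mpr (Finset.mem_range.mpr (index_of_mem_prefixNodes ht hv).1)) ?_
  rintro ⟨m, j⟩ hu ⟨m', j'⟩ hv huv
  obtain rfl : m = m' := Fin.ext huv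
  have h1 := (index_of_mem_prefixNodes ht hu).2
  have h2 := (index_of_mem_prefixNodes ht hv).2
  congr 1
  apply Fin.ext
  simp only at h1 h2
  omega

theorem sum_prefixNodes_sum_leaves {E : Type*} [AddCommMonoid E] (l : Fin T → E) {t : ℕ}
    (ht : t ≤ T) :
    ∑ v ∈ prefixNodes T t, ∑ s ∈ Finset.univ.filter (fun s : Fin T => (s : ℕ) ∈ leaves v), l s =
      ∑ s ∈ Finset.univ.filter (fun s : Fin T => (s : ℕ) < t), l s := by
  classical
  rw [← Finset.sum_biUnion]
  · congr 1
    ext s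
    simp only [Finset.mem_biUnion, Finset.mem_filter, Finset.mem_univ, true_and]
    exact prefixNodes_cover ht s
  · intro u hu v hv huv
    rw [Function.onFun, Finset.disjoint_left]
    intro s hs hs'
    exact Finset.disjoint_left.mp (prefixNodes_disjoint hu hv huv)
      (Finset.mem_filter.mp hs).2 (Finset.mem_filter.mp hs').2

/-- The estimate of a prefix sum is the exact sum plus `depth T` noise vectors with different
indices. -/
theorem exists_injective_prefixEstimate_eq (t : Fin (T + 1)) (ht : (t : ℕ) < 2 ^ depth T) :
    ∃ e : Fin (depth T) → NoiseIndex T, Function.Injective e ∧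
      ∀ (l : Fin T → EuclideanSpace ℝ (Fin N)) (ω : Noise N T),
        prefixEstimate l ω t =
          ∑ s ∈ Finset.univ.filter (fun s : Fin T => (s : ℕ) < t), l s + ∑ i, ω (e i) := by
  classical
  set F := Finset.univ.filter
    (fun i : Fin (depth T) => (i : ℕ) < depth T - (prefixNodes T t).card) with hF
  have hFcard : F.card = depth T - (prefixNodes T t).card := by
    rw [hF, Fin.card_filter_val_lt]
    omega
  -- The noise indices read at time `t`: the nodes of the minimum set and the padding, `depth T` in
  -- total.
  let J : Finset (NoiseIndex T) :=
    (prefixNodes T t).disjSum (F.map ⟨fun i => (t, i), fun i j h => (Prod.mk.inj h).2⟩)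
  have hJ : J.card = depth T := by
    have := card_prefixNodes_le_depth ht
    rw [Finset.card_disjSum, Finset.card_map, hFcard]
    omega
  let e := (J.equivFinOfCardEq hJ).symm
  refine ⟨fun i => e i, Subtype.val_injective.comp e.injective, fun l ω => ?_⟩
  have h1 : ∑ i, ω (e i) = ∑ j ∈ J, ω j := by
    rw [Equiv.sum_comp e (fun j : J => ω j), Finset.sum_coe_sort J]
  rw [h1, Finset.sum_disjSum, Finset.sum_map, ← sum_prefixNodes_sum_leaves l t.is_le,
    prefixEstimate]
  simp only [nodeValue, Finset.sum_add_distrib]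
  rw [add_assoc]
  rfl

theorem lt_two_pow_depth (t : Fin T) : (t : ℕ) < 2 ^ depth T :=
  lt_of_lt_of_le t.2 (Nat.le_pow_clog one_lt_two T)

/-! ### Privacy -/

/-- The translation of the noise that compensates the difference of two loss sequences. -/
def noiseShift (l l' : Fin T → EuclideanSpace ℝ (Fin N)) : Noise N T :=
  Sum.elim
    (fun v => if (v.1 : ℕ) < depth T then
      ∑ s ∈ Finset.univ.filter (fun s : Fin T => (s : ℕ) ∈ leaves v), (l s - l' s) else 0)
    (fun _ => 0)

/-- Every node used lies below the root level, so leaving the root unshifted does no harm; this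
keeps the shift to `depth T` levels instead of `depth T + 1`. -/
theorem prefixEstimate_add_noiseShift (l l' : Fin T → EuclideanSpace ℝ (Fin N)) (ω : Noise N T)
    (t : Fin (T + 1)) (ht : (t : ℕ) < 2 ^ depth T) :
    prefixEstimate l' (fun j => ω j + noiseShift l l' j) t = prefixEstimate l ω t := by
  rw [prefixEstimate, prefixEstimate]
  congr 1
  · refine Finset.sum_congr rfl fun v hv => ?_
    simp only [nodeValue, noiseShift, Sum.elim_inl, if_pos (index_of_mem_prefixNodes ht hv).1,
      Finset.sum_sub_distrib]
    abel
  · refine Finset.sum_congr rfl fun i _ => ?_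
    simp [noiseShift]

theorem l1_sub_le_two_mul_l1Radius {Y : Set (EuclideanSpace ℝ (Fin N))}
    (hY : BddAbove ((fun l => ∑ i, |l i|) '' Y)) {a b : EuclideanSpace ℝ (Fin N)} (ha : a ∈ Y)
    (hb : b ∈ Y) : ∑ i, |(a - b) i| ≤ 2 * l1Radius Y := by
  have h1 : ∑ i, |a i| ≤ l1Radius Y := le_csSup hY ⟨a, ha, rfl⟩
  have h2 : ∑ i, |b i| ≤ l1Radius Y := le_csSup hY ⟨b, hb, rfl⟩
  calc ∑ i, |(a - b) i| ≤ ∑ i, (|a i| + |b i|) := Finset.sum_le_sum fun i _ => abs_sub _ _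
    _ ≤ 2 * l1Radius Y := by
      rw [Finset.sum_add_distrib]
      linarith

theorem l1Radius_nonneg (Y : Set (EuclideanSpace ℝ (Fin N))) : 0 ≤ l1Radius Y := by
  refine Real.sSup_nonneg ?_
  rintro _ ⟨l, _, rfl⟩
  positivity

/-- Only nodes above the leaf `t₀` can be shifted, at most one on each of the `depth T` levels below
the root, and each by `l t₀ - l' t₀`. -/
theorem sum_l1_noiseShift_le {Y : Set (EuclideanSpace ℝ (Fin N))}
    (hY : BddAbove ((fun l => ∑ i, |l i|) '' Y)) {l l' : Fin T → EuclideanSpace ℝ (Fin N)}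
    (hl : ∀ t, l t ∈ Y) (hl' : ∀ t, l' t ∈ Y) (t₀ : Fin T) (h : ∀ t, t ≠ t₀ → l t = l' t) :
    ∑ j, ∑ i, |noiseShift l l' j i| ≤ 2 * l1Radius Y * depth T := by
  classical
  set C : Finset (TreeNode T) :=
    Finset.univ.filter (fun v => (t₀ : ℕ) ∈ leaves v ∧ (v.1 : ℕ) < depth T) with hC
  have hcard : C.card ≤ depth T := by
    rw [← Finset.card_range (depth T)]
    refine Finset.card_le_card_of_injOn (fun v => (v.1 : ℕ)) (fun v hv => ?_) ?_
    · exact Finset.mem_coe.mpr (Finset.mem_range.mpr (Finset.mem_filter.mp hv).2.2)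
    · intro u hu v hv huv
      exact eq_of_level_eq (Finset.mem_filter.mp hu).2.1 (Finset.mem_filter.mp hv).2.1 huv.symm
  have hv : ∀ v : TreeNode T, ∑ i, |noiseShift l l' (Sum.inl v) i| ≤
      if v ∈ C then 2 * l1Radius Y else 0 := by
    intro v
    have hsum : ∑ s ∈ Finset.univ.filter (fun s : Fin T => (s : ℕ) ∈ leaves v), (l s - l' s) =
        if (t₀ : ℕ) ∈ leaves v then l t₀ - l' t₀ else 0 := by
      rw [Finset.sum_filter, Finset.sum_eq_single t₀]
      · intro s _ hs
        simp [h s hs]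
      · simp
    simp only [noiseShift, Sum.elim_inl, hsum, hC, Finset.mem_filter, Finset.mem_univ, true_and]
    by_cases h1 : (t₀ : ℕ) ∈ leaves v <;> by_cases h2 : (v.1 : ℕ) < depth T <;>
      simp only [h1, h2, if_true, if_false, and_self, and_true, and_false]
    · exact l1_sub_le_two_mul_l1Radius hY (hl t₀) (hl' t₀)
    all_goals simp
  rw [Fintype.sum_sum_type]
  have hr : ∑ p : Fin (T + 1) × Fin (depth T), ∑ i, |noiseShift l l' (Sum.inr p) i| = 0 := by
    simp [noiseShift]
  rw [hr, add_zero]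
  calc _ ≤ ∑ v : TreeNode T, if v ∈ C then 2 * l1Radius Y else 0 :=
        Finset.sum_le_sum fun v _ => hv v
    _ = C.card * (2 * l1Radius Y) := by
        rw [Finset.sum_ite_mem, Finset.univ_inter, Finset.sum_const, nsmul_eq_mul]
    _ ≤ _ := by
        have h1 := l1Radius_nonneg Y
        have h2 : (C.card : ℝ) ≤ depth T := by exact_mod_cast hcard
        nlinarith

theorem isDifferentiallyPrivate_predictions {X Y : Set (EuclideanSpace ℝ (Fin N))}
    (hY : BddAbove ((fun l => ∑ i, |l i|) '' Y)) (R : EuclideanSpace ℝ (Fin N) → ℝ) (η : ℝ)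
    {ε lam : ℝ} (hε : 0 < ε) (hlam : lam = 2 * l1Radius Y * (depth T : ℝ) / ε) :
    IsDifferentiallyPrivate (noiseLaw T (laplaceVec N lam)) (predictions X R η) Y ε 0 := by
  rintro l l' hl hl' ⟨t₀, ht₀⟩ S -
  have hlam0 : 0 ≤ lam := by
    have := l1Radius_nonneg Y
    rw [hlam]
    positivity
  have hprob := isProbabilityMeasure_laplaceVec (N := N) hlam0
  have hbound := sum_l1_noiseShift_le hY hl hl' t₀ ht₀
  rw [(div_eq_iff hε.ne').mp hlam.symm] at hbound
  have hset : {ω | predictions X R η l ω ∈ S} =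
      (fun (ω : Noise N T) j => ω j + noiseShift l l' j) ⁻¹'
        {ω | predictions X R η l' ω ∈ S} := by
    ext ω
    simp only [Set.mem_ofPred_eq, Set.mem_preimage]
    have : predictions X R η l' (fun j => ω j + noiseShift l l' j) = predictions X R η l ω := by
      funext t
      rw [predictions, predictions, prefixEstimate_add_noiseShift]
      exact lt_two_pow_depth t
    rw [this]
  have hmain : (noiseLaw T (laplaceVec N lam)).map (fun ω j => ω j + noiseShift l l' j) ≤
      ENNReal.ofReal (Real.exp ε) • noiseLaw T (laplaceVec N lam) := by
    -- At scale zero the noise is a point mass and no density bound is available, but then `hbound`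
    -- forces the shift to vanish.
    rcases hlam0.eq_or_lt with h0 | hpos
    · rw [← h0, zero_mul] at hbound
      have hz : ∀ j, noiseShift l l' j = 0 := by
        intro j
        have h1 := (Finset.sum_eq_zero_iff_of_nonneg (fun j _ => by positivity)).mp
          (le_antisymm hbound (by positivity)) j (Finset.mem_univ j)
        ext i
        have h2 := (Finset.sum_eq_zero_iff_of_nonneg (fun i _ => abs_nonneg _)).mp h1 i
          (Finset.mem_univ i)
        simpa using h2
      simp only [hz, add_zero, Measure.map_id']
      refine Measure.le_iff.mpr fun s _ => ?_
      rw [Measure.smul_apply, smul_eq_mul]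
      refine le_mul_of_one_le_left' ?_
      rw [ENNReal.one_le_ofReal]
      exact Real.one_le_exp hε.le
    · have h := map_pi_le_smul_pi (fun _ : NoiseIndex T => laplaceVec N lam)
        (fun j x => x + noiseShift l l' j) (fun j => by fun_prop)
        (fun j => ENNReal.ofReal (Real.exp ((∑ i, |noiseShift l l' j i|) / lam)))
        (fun j => by simp [Real.exp_pos]) (fun j => ENNReal.ofReal_ne_top)
        (fun j => map_add_laplaceVec_le hpos _)
      rw [← ENNReal.ofReal_prod_of_nonneg (fun j _ => (Real.exp_pos _).le), ← Real.exp_sum,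
        ← Finset.sum_div] at h
      refine h.trans (Measure.le_iff.mpr fun s _ => ?_)
      rw [Measure.smul_apply, Measure.smul_apply, smul_eq_mul, smul_eq_mul]
      have h3 : (∑ j, ∑ i, |noiseShift l l' j i|) / lam ≤ ε := by
        rw [div_le_iff₀ hpos]
        linarith
      exact mul_le_mul_left (ENNReal.ofReal_le_ofReal (Real.exp_le_exp.mpr h3)) _
  rw [ENNReal.ofReal_zero, add_zero, hset]
  have hm : Measurable (fun (ω : Noise N T) j => ω j + noiseShift l l' j) := by fun_prop
  -- Both inequalities hold for arbitrary sets, so the prediction map need not be known to be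
  -- measurable here.
  exact (Measure.le_map_apply hm.aemeasurable _).trans (hmain {ω | predictions X R η l' ω ∈ S})

/-! ### Relative interior of a convex set -/

section RelativeInterior

variable {E : Type*} [NormedAddCommGroup E] [NormedSpace ℝ E]

theorem mem_intrinsicInterior_iff_dist {X : Set E} {x : E} :
    x ∈ intrinsicInterior ℝ X ↔ x ∈ affineSpan ℝ X ∧
      ∃ r > 0, ∀ w ∈ affineSpan ℝ X, dist w x < r → w ∈ X := by
  rw [mem_intrinsicInterior]
  constructor
  · rintro ⟨y, hy, rfl⟩
    obtain ⟨r, hr, h⟩ := Metric.mem_nhds_iff.mp (mem_interior_iff_mem_nhds.mp hy)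
    exact ⟨y.2, r, hr, fun w hw hd => h (show (⟨w, hw⟩ : affineSpan ℝ X) ∈ Metric.ball y r from hd)⟩
  · rintro ⟨hx, r, hr, h⟩
    refine ⟨⟨x, hx⟩, mem_interior_iff_mem_nhds.mpr (Metric.mem_nhds_iff.mpr ⟨r, hr, ?_⟩), rfl⟩
    intro w hw
    exact h w w.2 hw

theorem combo_mem_intrinsicInterior {X : Set E} (hX : Convex ℝ X) {x x₀ : E} (hx : x ∈ X)
    (hx₀ : x₀ ∈ intrinsicInterior ℝ X) {s : ℝ} (hs : 0 < s) (hs1 : s ≤ 1) :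
    (1 - s) • x + s • x₀ ∈ intrinsicInterior ℝ X := by
  have hx₀X := intrinsicInterior_subset hx₀
  rw [mem_intrinsicInterior_iff_dist] at hx₀ ⊢
  obtain ⟨hspan, r, hr, h⟩ := hx₀
  have hz : (1 - s) • x + s • x₀ ∈ affineSpan ℝ X :=
    subset_affineSpan ℝ X (hX hx hx₀X (by linarith) hs.le (by ring))
  refine ⟨hz, s * r, by positivity, fun w hw hd => ?_⟩
  set z := (1 - s) • x + s • x₀ with hz_def
  -- The preimage of `w` under the homothety with centre `x` and ratio `s`, which maps the `r`-ball
  -- about `x₀` onto the `s * r`-ball about `z`.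
  have hw₀ : s⁻¹ • (w - z) + x₀ ∈ affineSpan ℝ X :=
    AffineSubspace.vadd_mem_of_mem_direction
      (Submodule.smul_mem _ _ (AffineSubspace.vsub_mem_direction hw hz)) hspan
  have hmem := h _ hw₀ (by
    rw [dist_eq_norm, add_sub_cancel_right, norm_smul, Real.norm_of_nonneg (by positivity),
      ← dist_eq_norm, inv_mul_lt_iff₀ hs]
    exact hd)
  have := hX hx hmem (by linarith : (0 : ℝ) ≤ 1 - s) hs.le (by ring)
  rwa [smul_add, smul_inv_smul₀ hs.ne', add_comm (w - z), ← add_assoc, ← hz_def,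
    add_sub_cancel] at this

/-- A lower bound on the second derivative along a segment gives strong convexity there. -/
theorem segment_strong_convexity {R : E → ℝ} {U : Set E} (hU : IsOpen U)
    (hR : ContDiffOn ℝ 2 R U) {p d : E} {h : ℝ}
    (hseg : ∀ τ ∈ Set.Icc (0 : ℝ) 1, p + τ • d ∈ U)
    (hh : ∀ τ ∈ Set.Icc (0 : ℝ) 1, h ≤ fderiv ℝ (fderiv ℝ R) (p + τ • d) d d)
    {τ : ℝ} (hτ : τ ∈ Set.Icc (0 : ℝ) 1) :
    R (p + τ • d) ≤ (1 - τ) * R p + τ * R (p + d) - h / 2 * (τ * (1 - τ)) := by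
  have hline : ∀ σ : ℝ, HasDerivAt (fun σ : ℝ => p + σ • d) d σ := fun σ => by
    simpa using ((hasDerivAt_id σ).smul_const d).const_add p
  have h1 : ∀ σ ∈ Set.Icc (0 : ℝ) 1,
      HasDerivAt (fun σ => R (p + σ • d)) (fderiv ℝ R (p + σ • d) d) σ := fun σ hσ =>
    HasFDerivAt.comp_hasDerivAt σ
      ((hR.contDiffAt (hU.mem_nhds (hseg σ hσ))).differentiableAt two_ne_zero).hasFDerivAt
      (hline σ)
  have h2 : ∀ σ ∈ Set.Icc (0 : ℝ) 1, HasDerivAt (fun σ => fderiv ℝ R (p + σ • d) d)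
      (fderiv ℝ (fderiv ℝ R) (p + σ • d) d d) σ := fun σ hσ => by
    have hc : ContDiffAt ℝ 1 (fderiv ℝ R) (p + σ • d) :=
      (hR.contDiffAt (hU.mem_nhds (hseg σ hσ))).fderiv_right (by norm_num)
    have := HasFDerivAt.comp_hasDerivAt σ (hc.differentiableAt one_ne_zero).hasFDerivAt (hline σ)
    simpa using this.clm_apply (hasDerivAt_const σ d)
  have hsq : ∀ σ : ℝ, HasDerivAt (fun σ : ℝ => h / 2 * σ ^ 2) (h * σ) σ := fun σ =>
    ((hasDerivAt_pow 2 σ).const_mul (h / 2)).congr_deriv (by push_cast; ring)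
  have hlin : ∀ σ : ℝ, HasDerivAt (fun σ : ℝ => h * σ) h σ := fun σ => by
    simpa using (hasDerivAt_id σ).const_mul h
  -- Subtracting the parabola leaves a nonnegative second derivative; the chord inequality then
  -- gains h/2 · (τ - τ²).
  have hconv : ConvexOn ℝ (Set.Icc (0 : ℝ) 1) (fun σ => R (p + σ • d) - h / 2 * σ ^ 2) := by
    refine convexOn_of_hasDerivWithinAt2_nonneg (convex_Icc 0 1)
      (f' := fun σ => fderiv ℝ R (p + σ • d) d - h * σ)
      (f'' := fun σ => fderiv ℝ (fderiv ℝ R) (p + σ • d) d d - h) ?_ ?_ ?_ ?_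
    · exact fun σ hσ => ((h1 σ hσ).sub (hsq σ)).continuousAt.continuousWithinAt
    · exact fun σ hσ => ((h1 σ (interior_subset hσ)).sub (hsq σ)).hasDerivWithinAt
    · exact fun σ hσ => ((h2 σ (interior_subset hσ)).sub (hlin σ)).hasDerivWithinAt
    · exact fun σ hσ => sub_nonneg.mpr (hh σ (interior_subset hσ))
  have := hconv.2 (Set.left_mem_Icc.mpr zero_le_one) (Set.right_mem_Icc.mpr zero_le_one)
    (sub_nonneg.mpr hτ.2) hτ.1 (by ring)
  simp only [smul_eq_mul, mul_zero, mul_one, zero_add, zero_smul, add_zero, one_smul, ne_eq,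
    OfNat.ofNat_ne_zero, not_false_eq_true, zero_pow, sub_zero, one_pow] at this
  linarith

end RelativeInterior

/-! ### The dual local norm -/

/-- A positive definite form is bounded below by its minimum on the unit sphere, so the local unit
ball is bounded. This ensures that the real `sSup` in `dualHessNorm` is a genuine supremum, not the
default 0. -/
theorem bddAbove_dualHessNorm {R : EuclideanSpace ℝ (Fin N) → ℝ} {x : EuclideanSpace ℝ (Fin N)}
    (hpos : ∀ y, y ≠ 0 → 0 < fderiv ℝ (fderiv ℝ R) x y y) (l : EuclideanSpace ℝ (Fin N)) :
    BddAbove ((fun y => inner ℝ l y) '' {y | hessNorm R x y ≤ 1}) := by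
  set B := fderiv ℝ (fderiv ℝ R) x with hB
  obtain ⟨m, hm, hmB⟩ : ∃ m > 0, ∀ y, m * ‖y‖ ^ 2 ≤ B y y := by
    have hcont : Continuous fun y => B y y := B.continuous.clm_apply continuous_id
    rcases (Metric.sphere (0 : EuclideanSpace ℝ (Fin N)) 1).eq_empty_or_nonempty with h | h
    · refine ⟨1, one_pos, fun y => ?_⟩
      by_cases hy : y = 0
      · simp [hy]
      · exfalso
        have : ‖y‖⁻¹ • y ∈ Metric.sphere (0 : EuclideanSpace ℝ (Fin N)) 1 := by
          simp [norm_smul, hy]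
        rw [h] at this
        exact this
    · obtain ⟨y₀, hy₀, hmin⟩ := (isCompact_sphere 0 1).exists_isMinOn h hcont.continuousOn
      have hy₀' : y₀ ≠ 0 := by
        rintro rfl
        simp at hy₀
      refine ⟨B y₀ y₀, hpos y₀ hy₀', fun y => ?_⟩
      by_cases hy : y = 0
      · simp [hy]
      · have hn : 0 < ‖y‖ := norm_pos_iff.mpr hy
        have h1 : B y₀ y₀ ≤ B (‖y‖⁻¹ • y) (‖y‖⁻¹ • y) := hmin (by simp [norm_smul, hy])
        simp only [map_smul, smul_apply, smul_eq_mul] at h1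
        calc B y₀ y₀ * ‖y‖ ^ 2 ≤ (‖y‖⁻¹ * (‖y‖⁻¹ * B y y)) * ‖y‖ ^ 2 := by gcongr
          _ = B y y := by field_simp
  refine ⟨‖l‖ * √(1 / m), ?_⟩
  rintro _ ⟨y, hy, rfl⟩
  have hy1 : B y y ≤ 1 := by
    have : √(B y y) ≤ 1 := hy
    rwa [Real.sqrt_le_one] at this
  refine (real_inner_le_norm l y).trans ?_
  gcongr
  apply Real.le_sqrt_of_sq_le
  rw [le_div_iff₀ hm]
  linarith [hmB y]

theorem inner_sq_le_hess_mul_dualHessNorm_sq {R : EuclideanSpace ℝ (Fin N) → ℝ}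
    {x : EuclideanSpace ℝ (Fin N)} (hpos : ∀ y, y ≠ 0 → 0 < fderiv ℝ (fderiv ℝ R) x y y)
    (l d : EuclideanSpace ℝ (Fin N)) :
    inner ℝ l d ^ 2 ≤ fderiv ℝ (fderiv ℝ R) x d d * dualHessNorm R x l ^ 2 := by
  by_cases hd : d = 0
  · simp [hd]
  set H := fderiv ℝ (fderiv ℝ R) x d d with hH
  have hH0 : 0 < H := hpos d hd
  have hs : 0 < √H := Real.sqrt_pos.mpr hH0
  have hss : √H ^ 2 = H := Real.sq_sqrt hH0.le
  -- Testing the dual norm on `d` normalised, with both signs a = ±1, bounds the absolute value.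
  have key : ∀ a : ℝ, a ^ 2 = 1 → a * inner ℝ l d ≤ √H * dualHessNorm R x l := by
    intro a ha
    have hmem : (a * (√H)⁻¹) • d ∈ {y | hessNorm R x y ≤ 1} := by
      have h1 : fderiv ℝ (fderiv ℝ R) x ((a * (√H)⁻¹) • d) ((a * (√H)⁻¹) • d) = 1 := by
        simp only [map_smul, smul_apply, smul_eq_mul, ← hH]
        calc _ = a ^ 2 * (H / √H ^ 2) := by field_simp
          _ = 1 := by rw [ha, hss, div_self hH0.ne', one_mul]
      change √_ ≤ 1
      rw [h1, Real.sqrt_one]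
    have h2 : inner ℝ l ((a * (√H)⁻¹) • d) ≤ dualHessNorm R x l :=
      le_csSup (bddAbove_dualHessNorm hpos l) ⟨_, hmem, rfl⟩
    rw [inner_smul_right] at h2
    calc a * inner ℝ l d = √H * (a * (√H)⁻¹ * inner ℝ l d) := by field_simp
      _ ≤ _ := by gcongr
  have habs : |inner ℝ l d| ≤ √H * dualHessNorm R x l :=
    abs_le.mpr ⟨by linarith [key (-1) (by norm_num)], by linarith [key 1 (by norm_num)]⟩
  calc inner ℝ l d ^ 2 = |inner ℝ l d| ^ 2 := (sq_abs _).symm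
    _ ≤ (√H * dualHessNorm R x l) ^ 2 := by gcongr
    _ = _ := by rw [mul_pow, hss]

/-! ### Stability of the regularized minimiser -/

section Stability

variable {X U : Set (EuclideanSpace ℝ (Fin N))} {R : EuclideanSpace ℝ (Fin N) → ℝ}

/-- Cauchy–Schwarz at a relative interior point. This covers the case M = 0, where the modulus ⟨l,
d⟩² / M is meaningless. -/
theorem inner_eq_zero_of_dualHessNorm_sq_le_zero (hXne : X.Nonempty) (hXconv : Convex ℝ X)
    (hXU : intrinsicInterior ℝ X ⊆ U)
    (hRhess : ∀ x ∈ X ∩ U, ∀ y, y ≠ 0 → 0 < fderiv ℝ (fderiv ℝ R) x y y)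
    {l : EuclideanSpace ℝ (Fin N)} (h : ∀ x ∈ X ∩ U, dualHessNorm R x l ^ 2 ≤ 0)
    (d : EuclideanSpace ℝ (Fin N)) : inner ℝ l d = 0 := by
  obtain ⟨x₀, hx₀⟩ := hXne.intrinsicInterior hXconv
  have hmem : x₀ ∈ X ∩ U := ⟨intrinsicInterior_subset hx₀, hXU hx₀⟩
  have h1 := inner_sq_le_hess_mul_dualHessNorm_sq (hRhess x₀ hmem) l d
  rw [le_antisymm (h x₀ hmem) (sq_nonneg _), mul_zero] at h1
  exact pow_eq_zero_iff two_ne_zero |>.mp (le_antisymm h1 (sq_nonneg _))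

/-- The regularizer is strongly convex along a direction `y - x` with the modulus given by the
dual local norm of any vector that is not orthogonal to it. -/
theorem regularizer_strong_convexity (hXne : X.Nonempty) (hXconv : Convex ℝ X)
    (hRcont : ContinuousOn R X) (hUopen : IsOpen U) (hXU : intrinsicInterior ℝ X ⊆ U)
    (hRsmooth : ContDiffOn ℝ 2 R U)
    (hRhess : ∀ x ∈ X ∩ U, ∀ y, y ≠ 0 → 0 < fderiv ℝ (fderiv ℝ R) x y y)
    {l : EuclideanSpace ℝ (Fin N)} {M : ℝ} (hM : 0 < M)
    (hl : ∀ x ∈ X ∩ U, dualHessNorm R x l ^ 2 ≤ M) {x y : EuclideanSpace ℝ (Fin N)} (hx : x ∈ X)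
    (hy : y ∈ X) {τ : ℝ} (hτ : τ ∈ Set.Icc (0 : ℝ) 1) :
    R (x + τ • (y - x)) ≤
      (1 - τ) * R x + τ * R y - inner ℝ l (y - x) ^ 2 / M / 2 * (τ * (1 - τ)) := by
  obtain ⟨x₀, hx₀⟩ := hXne.intrinsicInterior hXconv
  have hseg : ∀ σ ∈ Set.Icc (0 : ℝ) 1, x + σ • (y - x) ∈ X := fun σ hσ =>
    hXconv.add_smul_sub_mem hx hy hσ
  -- The segment may leave `U` along the relative boundary. Contracting it towards `x₀` keeps it in
  -- the relative interior and scales its direction by 1 - s; continuity of `R` on `X` then allows s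
  -- → 0.
  have hpert : ∀ s ∈ Set.Ioo (0 : ℝ) 1,
      R ((1 - s) • (x + τ • (y - x)) + s • x₀) ≤
        (1 - τ) * R ((1 - s) • x + s • x₀) + τ * R ((1 - s) • y + s • x₀) -
          (1 - s) ^ 2 * (inner ℝ l (y - x) ^ 2 / M) / 2 * (τ * (1 - τ)) := by
    intro s hs
    have hpt : ∀ σ : ℝ, (1 - s) • x + s • x₀ + σ • ((1 - s) • (y - x)) =
        (1 - s) • (x + σ • (y - x)) + s • x₀ := fun σ => by module
    have hri : ∀ σ ∈ Set.Icc (0 : ℝ) 1, (1 - s) • x + s • x₀ + σ • ((1 - s) • (y - x)) ∈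
        intrinsicInterior ℝ X := fun σ hσ => by
      rw [hpt]
      exact combo_mem_intrinsicInterior hXconv (hseg σ hσ) hx₀ hs.1 hs.2.le
    have h := segment_strong_convexity hUopen hRsmooth (p := (1 - s) • x + s • x₀)
      (d := (1 - s) • (y - x)) (h := (1 - s) ^ 2 * (inner ℝ l (y - x) ^ 2 / M))
      (fun σ hσ => hXU (hri σ hσ)) (fun σ hσ => ?_) hτ
    · rw [hpt] at h
      rwa [show (1 - s) • x + s • x₀ + (1 - s) • (y - x) = (1 - s) • y + s • x₀ by module] at h
    · have hmem : (1 - s) • x + s • x₀ + σ • ((1 - s) • (y - x)) ∈ X ∩ U :=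
        ⟨intrinsicInterior_subset (hri σ hσ), hXU (hri σ hσ)⟩
      have h1 := inner_sq_le_hess_mul_dualHessNorm_sq (hRhess _ hmem) l ((1 - s) • (y - x))
      have hnn : 0 ≤ fderiv ℝ (fderiv ℝ R) ((1 - s) • x + s • x₀ + σ • ((1 - s) • (y - x)))
          ((1 - s) • (y - x)) ((1 - s) • (y - x)) := by
        by_cases h0 : (1 - s) • (y - x) = 0
        · simp [h0]
        · exact (hRhess _ hmem _ h0).le
      rw [inner_smul_right, mul_pow] at h1
      rw [← mul_div_assoc, div_le_iff₀ hM]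
      exact h1.trans (mul_le_mul_of_nonneg_left (hl _ hmem) hnn)
  have hlim : ∀ z ∈ X, Tendsto (fun s : ℝ => R ((1 - s) • z + s • x₀)) (𝓝[>] 0) (𝓝 (R z)) := by
    intro z hz
    have hc : Tendsto (fun s : ℝ => (1 - s) • z + s • x₀) (𝓝[>] 0) (𝓝 z) := by
      have : Continuous fun s : ℝ => (1 - s) • z + s • x₀ := by fun_prop
      have h0 := this.tendsto 0
      simp only [sub_zero, one_smul, zero_smul, add_zero] at h0
      exact h0.mono_left nhdsWithin_le_nhds
    refine (hRcont z hz).tendsto.comp (tendsto_nhdsWithin_iff.mpr ⟨hc, ?_⟩)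
    filter_upwards [Ioo_mem_nhdsGT (zero_lt_one' ℝ)] with s hs
    exact hXconv hz (intrinsicInterior_subset hx₀) (by linarith [hs.2]) hs.1.le (by ring)
  have hsq : Tendsto (fun s : ℝ => (1 - s) ^ 2 * (inner ℝ l (y - x) ^ 2 / M) / 2 * (τ * (1 - τ)))
      (𝓝[>] 0) (𝓝 (inner ℝ l (y - x) ^ 2 / M / 2 * (τ * (1 - τ)))) := by
    have : Continuous fun s : ℝ =>
        (1 - s) ^ 2 * (inner ℝ l (y - x) ^ 2 / M) / 2 * (τ * (1 - τ)) := by fun_prop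
    have h0 := this.tendsto 0
    simp only [sub_zero, one_pow, one_mul] at h0
    exact h0.mono_left nhdsWithin_le_nhds
  refine le_of_tendsto_of_tendsto (hlim _ (hseg τ hτ))
    ((((hlim x hx).const_mul (1 - τ)).add ((hlim y hy).const_mul τ)).sub hsq) ?_
  filter_upwards [Ioo_mem_nhdsGT (zero_lt_one' ℝ)] with s hs
  exact hpert s hs

/-- Strong convexity makes the objective at `y` exceed its minimum by at least c² / (2M), with c =
⟨l, y - x⟩, and this gain pays for -ηc up to η²M / 2. In the application `y` is the next leader. -/
theorem inner_sub_le_of_isMinOn (hXne : X.Nonempty) (hXconv : Convex ℝ X)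
    (hRcont : ContinuousOn R X) (hUopen : IsOpen U) (hXU : intrinsicInterior ℝ X ⊆ U)
    (hRsmooth : ContDiffOn ℝ 2 R U)
    (hRhess : ∀ x ∈ X ∩ U, ∀ y, y ≠ 0 → 0 < fderiv ℝ (fderiv ℝ R) x y y)
    {l L : EuclideanSpace ℝ (Fin N)} {M η : ℝ}
    (hl : ∀ x ∈ X ∩ U, dualHessNorm R x l ^ 2 ≤ M) {x y : EuclideanSpace ℝ (Fin N)} (hx : x ∈ X)
    (hmin : IsMinOn (fun y => η * inner ℝ y L + R y) X x) (hy : y ∈ X) :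
    η * inner ℝ l (x - y) ≤
      (η * inner ℝ y L + R y) - (η * inner ℝ x L + R x) + η ^ 2 / 2 * M := by
  have hxy : inner ℝ l (x - y) = -inner ℝ l (y - x) := by
    rw [← neg_sub, inner_neg_right]
  rw [hxy]
  set c : ℝ := inner ℝ l (y - x) with hc
  have hM0 : 0 ≤ M := by
    obtain ⟨x₀, hx₀⟩ := hXne.intrinsicInterior hXconv
    exact (sq_nonneg _).trans (hl x₀ ⟨intrinsicInterior_subset hx₀, hXU hx₀⟩)
  rcases hM0.eq_or_lt with rfl | hM
  · have h0 : c = 0 := inner_eq_zero_of_dualHessNorm_sq_le_zero hXne hXconv hXU hRhess hl _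
    have := hmin hy
    simp only [Set.mem_ofPred_eq] at this
    rw [h0]
    linarith
  -- Compare the minimum with the value at x + τ(y - x) and divide by τ; letting τ → 0 recovers the
  -- full constant.
  · have hstep : ∀ τ ∈ Set.Ioo (0 : ℝ) 1, c ^ 2 / M / 2 * (1 - τ) ≤
        (η * inner ℝ y L + R y) - (η * inner ℝ x L + R x) := by
      intro τ hτ
      have hτ' : τ ∈ Set.Icc (0 : ℝ) 1 := ⟨hτ.1.le, hτ.2.le⟩
      have h1 := regularizer_strong_convexity hXne hXconv hRcont hUopen hXU hRsmooth hRhess hM hl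
        hx hy hτ'
      have h2 := hmin (hXconv.add_smul_sub_mem hx hy hτ')
      simp only [Set.mem_ofPred_eq, inner_add_left, inner_smul_left, inner_sub_left,
        conj_trivial] at h2
      rw [← hc] at h1
      refine le_of_mul_le_mul_left ?_ hτ.1
      linarith
    have hlim : c ^ 2 / M / 2 ≤ (η * inner ℝ y L + R y) - (η * inner ℝ x L + R x) := by
      have hcont : Continuous fun τ : ℝ => c ^ 2 / M / 2 * (1 - τ) := by fun_prop
      have h0 := (hcont.tendsto 0).mono_left (nhdsWithin_le_nhds (s := Set.Ioi 0))
      rw [sub_zero, mul_one] at h0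
      refine le_of_tendsto h0 ?_
      filter_upwards [Ioo_mem_nhdsGT (zero_lt_one' ℝ)] with τ hτ
      exact hstep τ hτ
    have hamgm : -(η * c) ≤ c ^ 2 / M / 2 + η ^ 2 / 2 * M := by
      have h3 : 0 ≤ (c + η * M) ^ 2 / (2 * M) := by positivity
      have h4 : (c + η * M) ^ 2 / (2 * M) = c ^ 2 / M / 2 + η ^ 2 / 2 * M + η * c := by
        field_simp
        ring
      linarith
    linarith

end Stability

/-! ### The regularized minimiser -/

section RegArgmin

variable {X : Set (EuclideanSpace ℝ (Fin N))} {R : EuclideanSpace ℝ (Fin N) → ℝ}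

theorem continuousOn_regularized (hRcont : ContinuousOn R X) (η : ℝ)
    (L : EuclideanSpace ℝ (Fin N)) : ContinuousOn (fun y => η * inner ℝ y L + R y) X :=
  (Continuous.continuousOn (by fun_prop)).add hRcont

theorem regArgmin_spec (hXne : X.Nonempty) (hXcomp : IsCompact X) (hRcont : ContinuousOn R X)
    (η : ℝ) (L : EuclideanSpace ℝ (Fin N)) :
    regArgmin X R η L ∈ X ∧ IsMinOn (fun y => η * inner ℝ y L + R y) X (regArgmin X R η L) :=
  Classical.epsilon_spec
    (p := fun x => x ∈ X ∧ IsMinOn (fun y => η * inner ℝ y L + R y) X x)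
    (hXcomp.exists_isMinOn hXne (continuousOn_regularized hRcont η L))

theorem strictConvexOn_regularized (hRconv : StrictConvexOn ℝ X R) (η : ℝ)
    (L : EuclideanSpace ℝ (Fin N)) : StrictConvexOn ℝ X (fun y => η * inner ℝ y L + R y) := by
  refine ⟨hRconv.1, fun x hx y hy hxy a b ha hb hab => ?_⟩
  have := hRconv.2 hx hy hxy ha hb hab
  simp only [smul_eq_mul, inner_add_left, inner_smul_left, conj_trivial] at this ⊢
  linarith

/-- Any cluster point of minimisers as L' → L minimises the limiting objective, and strict convexity
leaves only one such point. Continuity supplies the measurability needed for the expectations. -/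
theorem continuous_regArgmin (hXne : X.Nonempty) (hXcomp : IsCompact X)
    (hRcont : ContinuousOn R X) (hRconv : StrictConvexOn ℝ X R) (η : ℝ) :
    Continuous (regArgmin X R η) := by
  have hspec := fun L => regArgmin_spec hXne hXcomp hRcont η L
  rw [continuous_iff_continuousAt]
  intro L
  refine hXcomp.tendsto_nhds_of_unique_mapClusterPt (Eventually.of_forall fun L' => (hspec L').1) ?_
  intro a ha hcl
  obtain ⟨F, hF, hFa⟩ := mapClusterPt_iff_ultrafilter.mp hcl
  refine (strictConvexOn_regularized hRconv η L).eq_of_isMinOn (fun y hy => ?_) (hspec L).2 ha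
    (hspec L).1
  have hRa : Tendsto (fun L' => R (regArgmin X R η L')) F (𝓝 (R a)) :=
    (hRcont a ha).tendsto.comp
      (tendsto_nhdsWithin_iff.mpr ⟨hFa, Eventually.of_forall fun L' => (hspec L').1⟩)
  have hid : Tendsto (fun L' => L') (F : Filter (EuclideanSpace ℝ (Fin N))) (𝓝 L) := hF
  exact le_of_tendsto_of_tendsto' (((hFa.inner hid).const_mul η).add hRa)
    (((tendsto_const_nhds.inner hid).const_mul η).add tendsto_const_nhds)
    (fun L' => (hspec L').2 hy)

end RegArgmin

/-! ### Regret of follow the regularized leader with a fixed perturbation -/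

section FixedPerturbation

variable {X U : Set (EuclideanSpace ℝ (Fin N))} {R : EuclideanSpace ℝ (Fin N) → ℝ}

theorem ftrl_sum_le (hXne : X.Nonempty) (hXcomp : IsCompact X) (hXconv : Convex ℝ X)
    (hRcont : ContinuousOn R X) (hUopen : IsOpen U) (hXU : intrinsicInterior ℝ X ⊆ U)
    (hRsmooth : ContDiffOn ℝ 2 R U)
    (hRhess : ∀ x ∈ X ∩ U, ∀ y, y ≠ 0 → 0 < fderiv ℝ (fderiv ℝ R) x y y)
    (l : ℕ → EuclideanSpace ℝ (Fin N)) (M : ℕ → ℝ) (η : ℝ) (z : EuclideanSpace ℝ (Fin N))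
    (n : ℕ) (hl : ∀ t < n, ∀ x ∈ X ∩ U, dualHessNorm R x (l t) ^ 2 ≤ M t)
    {u : EuclideanSpace ℝ (Fin N)} (hu : u ∈ X) :
    η * ∑ t ∈ Finset.range n, inner ℝ (l t) (regArgmin X R η (∑ s ∈ Finset.range t, l s + z)) ≤
      η * ∑ t ∈ Finset.range n, inner ℝ (l t) u + η * inner ℝ z u + R u -
        (η * inner ℝ z (regArgmin X R η z) + R (regArgmin X R η z)) +
        η ^ 2 / 2 * ∑ t ∈ Finset.range n, M t := by
  have hspec := fun L => regArgmin_spec hXne hXcomp hRcont η L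
  set x : ℕ → EuclideanSpace ℝ (Fin N) :=
    fun t => regArgmin X R η (∑ s ∈ Finset.range t, l s + z) with hx
  -- The minimal value of the perturbed objective is the potential: replacing `x m` by `x (m + 1)`
  -- in round `m` costs the stability term, after which the sum telescopes.
  have hind : ∀ m ≤ n, η * ∑ t ∈ Finset.range m, inner ℝ (l t) (x t) ≤
      (η * inner ℝ (x m) (∑ s ∈ Finset.range m, l s + z) + R (x m)) -
        (η * inner ℝ (x 0) z + R (x 0)) + η ^ 2 / 2 * ∑ t ∈ Finset.range m, M t := by
    intro m
    induction m with
    | zero => simp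
    | succ m ih =>
      intro hm
      have h1 := ih (Nat.le_of_succ_le hm)
      have h2 := inner_sub_le_of_isMinOn hXne hXconv hRcont hUopen hXU hRsmooth hRhess
        (hl m hm) (hspec (∑ s ∈ Finset.range m, l s + z)).1
        (hspec (∑ s ∈ Finset.range m, l s + z)).2 (hspec (∑ s ∈ Finset.range (m + 1), l s + z)).1
      change η * inner ℝ (l m) (x m - x (m + 1)) ≤
        (η * inner ℝ (x (m + 1)) (∑ s ∈ Finset.range m, l s + z) + R (x (m + 1))) -
          (η * inner ℝ (x m) (∑ s ∈ Finset.range m, l s + z) + R (x m)) + η ^ 2 / 2 * M m at h2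
      rw [Finset.sum_range_succ, Finset.sum_range_succ (fun s => l s), Finset.sum_range_succ M]
      rw [inner_sub_right, real_inner_comm (x (m + 1)) (l m)] at h2
      rw [inner_add_right] at h1 h2 ⊢
      rw [inner_add_right (x m)] at h2
      rw [inner_add_right (x (m + 1)) (∑ s ∈ Finset.range m, l s)]
      linarith
  have h3 := hind n le_rfl
  have h4 : η * inner ℝ (x n) (∑ s ∈ Finset.range n, l s + z) + R (x n) ≤
      η * inner ℝ u (∑ s ∈ Finset.range n, l s + z) + R u :=
    (hspec (∑ s ∈ Finset.range n, l s + z)).2 hu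
  have hx0 : x 0 = regArgmin X R η z := by simp [hx]
  rw [hx0, real_inner_comm z] at h3
  change η * ∑ t ∈ Finset.range n, inner ℝ (l t) (x t) ≤ _
  rw [real_inner_comm _ u, inner_add_left, sum_inner] at h4
  linarith

theorem inner_sub_le_width (hXcomp : IsCompact X) (z : EuclideanSpace ℝ (Fin N))
    {u v : EuclideanSpace ℝ (Fin N)} (hu : u ∈ X) (hv : v ∈ X) :
    inner ℝ z u - inner ℝ z v ≤ width X z := by
  have hc : ContinuousOn (fun x => inner ℝ z x) X := Continuous.continuousOn (by fun_prop)
  exact sub_le_sub (le_csSup (hXcomp.bddAbove_image hc) ⟨u, hu, rfl⟩)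
    (csInf_le (hXcomp.bddBelow_image hc) ⟨v, hv, rfl⟩)

theorem sub_le_regRange (hXcomp : IsCompact X) (hRcont : ContinuousOn R X)
    {u v : EuclideanSpace ℝ (Fin N)} (hu : u ∈ X) (hv : v ∈ X) : R u - R v ≤ regRange X R :=
  sub_le_sub (le_csSup (hXcomp.bddAbove_image hRcont) ⟨u, hu, rfl⟩)
    (csInf_le (hXcomp.bddBelow_image hRcont) ⟨v, hv, rfl⟩)

theorem realizedRegret_regArgmin_le {T : ℕ} (hXne : X.Nonempty) (hXcomp : IsCompact X)
    (hXconv : Convex ℝ X) (hRcont : ContinuousOn R X) (hUopen : IsOpen U)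
    (hXU : intrinsicInterior ℝ X ⊆ U) (hRsmooth : ContDiffOn ℝ 2 R U)
    (hRhess : ∀ x ∈ X ∩ U, ∀ y, y ≠ 0 → 0 < fderiv ℝ (fderiv ℝ R) x y y)
    (l : Fin T → EuclideanSpace ℝ (Fin N))
    (hl : ∀ t, BddAbove ((fun x => dualHessNorm R x (l t) ^ 2) '' (X ∩ U)))
    {η : ℝ} (hη : 0 < η) (z : EuclideanSpace ℝ (Fin N)) :
    realizedRegret X l (fun t => regArgmin X R η
        (∑ s ∈ Finset.univ.filter (fun s : Fin T => (s : ℕ) < t), l s + z)) ≤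
      regRange X R / η + η / 2 * sumSqDual R (X ∩ U) l + width X z := by
  classical
  -- Extension by zero, so that the induction over rounds can run on `ℕ`.
  set l' : ℕ → EuclideanSpace ℝ (Fin N) := fun n => if h : n < T then l ⟨n, h⟩ else 0 with hl'
  have hl't : ∀ t : Fin T, l' t = l t := fun t => by simp [hl']
  have hprefix : ∀ t : Fin T, ∑ s ∈ Finset.univ.filter (fun s : Fin T => (s : ℕ) < t), l s =
      ∑ s ∈ Finset.range t, l' s := by
    intro t
    refine Finset.sum_bij (fun s _ => (s : ℕ)) (fun s hs => by simpa using hs)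
      (fun s _ s' _ h => Fin.ext h) (fun n hn => ?_) (fun s _ => (hl't s).symm)
    have hn' := Finset.mem_range.mp hn
    exact ⟨⟨n, hn'.trans t.2⟩, Finset.mem_filter.mpr ⟨Finset.mem_univ _, hn'⟩, rfl⟩
  set M : ℕ → ℝ := fun n => sSup ((fun x => dualHessNorm R x (l' n) ^ 2) '' (X ∩ U)) with hM
  have hbound : ∀ t < T, ∀ x ∈ X ∩ U, dualHessNorm R x (l' t) ^ 2 ≤ M t := by
    intro t ht x hx
    refine le_csSup ?_ ⟨x, hx, rfl⟩
    have := hl ⟨t, ht⟩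
    rwa [← hl't] at this
  have hsum : ∑ t ∈ Finset.range T, M t = sumSqDual R (X ∩ U) l := by
    rw [Finset.sum_range, sumSqDual]
    exact Finset.sum_congr rfl fun t _ => by rw [hM, ← hl't]
  have key : ∀ u ∈ X, ∑ t, inner ℝ (l t) (regArgmin X R η
        (∑ s ∈ Finset.univ.filter (fun s : Fin T => (s : ℕ) < t), l s + z)) -
      (regRange X R / η + η / 2 * sumSqDual R (X ∩ U) l + width X z) ≤
        ∑ t, inner ℝ (l t) u := by
    intro u hu
    have h1 := ftrl_sum_le hXne hXcomp hXconv hRcont hUopen hXU hRsmooth hRhess l' M η z T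
      hbound hu
    rw [hsum, Finset.sum_range, Finset.sum_range] at h1
    simp only [hl't] at h1
    simp only [hprefix]
    have hx0 := (regArgmin_spec hXne hXcomp hRcont η z).1
    have h2 := inner_sub_le_width hXcomp z hu hx0
    have h3 := sub_le_regRange hXcomp hRcont hu hx0
    have h4 : η * (regRange X R / η) = regRange X R := by field_simp
    refine le_of_mul_le_mul_left ?_ hη
    have h5 := mul_le_mul_of_nonneg_left h2 hη.le
    linarith
  rw [realizedRegret, sub_le_comm]
  refine le_csInf (hXne.image _) ?_
  rintro _ ⟨u, hu, rfl⟩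
  exact key u hu

end FixedPerturbation

/-! ### Expected regret -/

variable {X U : Set (EuclideanSpace ℝ (Fin N))} {R : EuclideanSpace ℝ (Fin N) → ℝ}

theorem continuous_width (hXcomp : IsCompact X) : Continuous (width X) :=
  (hXcomp.continuous_sSup (f := fun z x => (inner ℝ z x : ℝ)) (by fun_prop)).sub
    (hXcomp.continuous_sInf (f := fun z x => (inner ℝ z x : ℝ)) (by fun_prop))

theorem width_nonneg (hXne : X.Nonempty) (hXcomp : IsCompact X)
    (z : EuclideanSpace ℝ (Fin N)) : 0 ≤ width X z := by
  obtain ⟨u, hu⟩ := hXne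
  simpa using inner_sub_le_width hXcomp z hu hu

theorem integrable_width (hXne : X.Nonempty) (hXcomp : IsCompact X)
    (μ : Measure (EuclideanSpace ℝ (Fin N))) (hμ : Integrable (fun z => ‖z‖) μ) :
    Integrable (width X) μ := by
  obtain ⟨C, hC⟩ := hXcomp.isBounded.exists_norm_le
  have habs : ∀ z, ∀ x ∈ X, |inner ℝ z x| ≤ ‖z‖ * C := fun z x hx =>
    (abs_real_inner_le_norm z x).trans (mul_le_mul_of_nonneg_left (hC x hx) (norm_nonneg z))
  refine (hμ.mul_const (2 * C)).mono' (continuous_width hXcomp).aestronglyMeasurable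
    (Eventually.of_forall fun z => ?_)
  rw [Real.norm_of_nonneg (width_nonneg hXne hXcomp z)]
  have h1 : sSup ((fun x => inner ℝ z x) '' X) ≤ ‖z‖ * C := by
    refine csSup_le (hXne.image _) ?_
    rintro _ ⟨x, hx, rfl⟩
    exact (abs_le.mp (habs z x hx)).2
  have h2 : -(‖z‖ * C) ≤ sInf ((fun x => inner ℝ z x) '' X) := by
    refine le_csInf (hXne.image _) ?_
    rintro _ ⟨x, hx, rfl⟩
    exact (abs_le.mp (habs z x hx)).1
  rw [width]
  linarith

theorem map_sum_noiseLaw (D : Measure (EuclideanSpace ℝ (Fin N))) [IsProbabilityMeasure D]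
    {k : ℕ} (e : Fin k → NoiseIndex T) (he : Function.Injective e) :
    (noiseLaw T D).map (fun ω => ∑ i, ω (e i)) = sumLaw k D := by
  rw [sumLaw, ← map_pi_comp_injective D e he, Measure.map_map (by fun_prop) (by fun_prop)]
  rfl

theorem integrable_inner_regArgmin {Ω : Type*} [MeasurableSpace Ω] (μ : Measure Ω)
    [IsFiniteMeasure μ] (hXne : X.Nonempty) (hXcomp : IsCompact X)
    (hRcont : ContinuousOn R X) (hRconv : StrictConvexOn ℝ X R) (η : ℝ)
    (a : EuclideanSpace ℝ (Fin N)) {f : Ω → EuclideanSpace ℝ (Fin N)} (hf : Measurable f) :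
    Integrable (fun ω => (inner ℝ a (regArgmin X R η (f ω)) : ℝ)) μ := by
  obtain ⟨C, hC⟩ := hXcomp.isBounded.exists_norm_le
  have hcont : Continuous fun L => (inner ℝ a (regArgmin X R η L) : ℝ) :=
    continuous_const.inner (continuous_regArgmin hXne hXcomp hRcont hRconv η)
  refine Integrable.of_bound (hcont.measurable.comp hf).aestronglyMeasurable (‖a‖ * C)
    (Eventually.of_forall fun ω => ?_)
  exact (norm_inner_le_norm _ _).trans
    (mul_le_mul_of_nonneg_left (hC _ (regArgmin_spec hXne hXcomp hRcont η _).1) (norm_nonneg a))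

/-- The injection `e` that selects the noise vectors depends on the round, but the law of their sum
does not. -/
theorem integral_inner_predictions (hXne : X.Nonempty) (hXcomp : IsCompact X)
    (hRcont : ContinuousOn R X) (hRconv : StrictConvexOn ℝ X R) (η : ℝ)
    (D : Measure (EuclideanSpace ℝ (Fin N))) [IsProbabilityMeasure D]
    (l : Fin T → EuclideanSpace ℝ (Fin N)) (t : Fin T) :
    Integrable (fun ω => (inner ℝ (l t) (predictions X R η l ω t) : ℝ)) (noiseLaw T D) ∧
    ∫ ω, inner ℝ (l t) (predictions X R η l ω t) ∂(noiseLaw T D) =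
      ∫ z, inner ℝ (l t) (regArgmin X R η
        (∑ s ∈ Finset.univ.filter (fun s : Fin T => (s : ℕ) < t), l s + z))
          ∂(sumLaw (depth T) D) := by
  have : IsProbabilityMeasure (noiseLaw T D) := by
    rw [noiseLaw]
    infer_instance
  obtain ⟨e, he, hest⟩ := exists_injective_prefixEstimate_eq (N := N) t.castSucc
    (lt_two_pow_depth t)
  have hpred : ∀ ω, predictions X R η l ω t = regArgmin X R η
      (∑ s ∈ Finset.univ.filter (fun s : Fin T => (s : ℕ) < t), l s + ∑ i, ω (e i)) := fun ω => by
    rw [predictions, hest]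
    rfl
  simp only [hpred]
  refine ⟨integrable_inner_regArgmin _ hXne hXcomp hRcont hRconv η _ (by fun_prop), ?_⟩
  have hcont : Continuous fun z => (inner ℝ (l t) (regArgmin X R η
      (∑ s ∈ Finset.univ.filter (fun s : Fin T => (s : ℕ) < t), l s + z)) : ℝ) :=
    continuous_const.inner ((continuous_regArgmin hXne hXcomp hRcont hRconv η).comp
      (continuous_const.add continuous_id))
  have hm : Measurable fun ω : Noise N T => ∑ i, ω (e i) := by fun_prop
  rw [← map_sum_noiseLaw D e he, integral_map hm.aemeasurable hcont.aestronglyMeasurable]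

theorem integrable_realizedRegret (hXne : X.Nonempty) (hXcomp : IsCompact X)
    (hRcont : ContinuousOn R X) (hRconv : StrictConvexOn ℝ X R) (η : ℝ)
    (D : Measure (EuclideanSpace ℝ (Fin N))) [IsProbabilityMeasure D]
    (l : Fin T → EuclideanSpace ℝ (Fin N)) :
    Integrable (fun ω => realizedRegret X l (predictions X R η l ω)) (noiseLaw T D) := by
  have : IsProbabilityMeasure (noiseLaw T D) := by
    rw [noiseLaw]
    infer_instance
  exact (integrable_finsetSum _ fun t _ =>
    (integral_inner_predictions hXne hXcomp hRcont hRconv η D l t).1).sub (integrable_const _)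

/-- The expected regret equals that of the leader perturbed by one noise vector used in all
rounds, since only the law of the perturbation of each round matters. -/
theorem integral_realizedRegret_predictions (hXne : X.Nonempty) (hXcomp : IsCompact X)
    (hRcont : ContinuousOn R X) (hRconv : StrictConvexOn ℝ X R) (η : ℝ)
    (D : Measure (EuclideanSpace ℝ (Fin N))) [IsProbabilityMeasure D]
    (l : Fin T → EuclideanSpace ℝ (Fin N)) :
    Integrable (fun z => realizedRegret X l (fun t => regArgmin X R η
        (∑ s ∈ Finset.univ.filter (fun s : Fin T => (s : ℕ) < t), l s + z)))
      (sumLaw (depth T) D) ∧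
    ∫ ω, realizedRegret X l (predictions X R η l ω) ∂(noiseLaw T D) =
      ∫ z, realizedRegret X l (fun t => regArgmin X R η
        (∑ s ∈ Finset.univ.filter (fun s : Fin T => (s : ℕ) < t), l s + z))
          ∂(sumLaw (depth T) D) := by
  have : IsProbabilityMeasure (noiseLaw T D) := by
    rw [noiseLaw]
    infer_instance
  have := isProbabilityMeasure_sumLaw (depth T) D
  have hint : ∀ t, Integrable (fun z => (inner ℝ (l t) (regArgmin X R η
      (∑ s ∈ Finset.univ.filter (fun s : Fin T => (s : ℕ) < t), l s + z)) : ℝ))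
        (sumLaw (depth T) D) := fun t =>
    integrable_inner_regArgmin _ hXne hXcomp hRcont hRconv η (l t) (by fun_prop)
  have h := fun t => integral_inner_predictions hXne hXcomp hRcont hRconv η D l t
  refine ⟨(integrable_finsetSum _ fun t _ => hint t).sub (integrable_const _), ?_⟩
  simp only [realizedRegret]
  rw [integral_sub (integrable_finsetSum _ fun t _ => (h t).1) (integrable_const _),
    integral_sub (integrable_finsetSum _ fun t _ => hint t) (integrable_const _),
    integral_finsetSum _ fun t _ => (h t).1, integral_finsetSum _ fun t _ => hint t]
  simp only [(h _).2, integral_const, probReal_univ]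

theorem integral_realizedRegret_le (hXne : X.Nonempty) (hXcomp : IsCompact X)
    (hXconv : Convex ℝ X) (hRcont : ContinuousOn R X) (hRconv : StrictConvexOn ℝ X R)
    (hUopen : IsOpen U) (hXU : intrinsicInterior ℝ X ⊆ U) (hRsmooth : ContDiffOn ℝ 2 R U)
    (hRhess : ∀ x ∈ X ∩ U, ∀ y, y ≠ 0 → 0 < fderiv ℝ (fderiv ℝ R) x y y)
    (D : Measure (EuclideanSpace ℝ (Fin N))) [IsProbabilityMeasure D]
    (hwidth : Integrable (width X) (sumLaw (depth T) D))
    (l : Fin T → EuclideanSpace ℝ (Fin N))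
    (hl : ∀ t, BddAbove ((fun x => dualHessNorm R x (l t) ^ 2) '' (X ∩ U)))
    {η : ℝ} (hη : 0 < η) :
    ∫ ω, realizedRegret X l (predictions X R η l ω) ∂(noiseLaw T D) ≤
      regRange X R / η + η / 2 * sumSqDual R (X ∩ U) l +
        ∫ z, width X z ∂(sumLaw (depth T) D) := by
  have := isProbabilityMeasure_sumLaw (depth T) D
  obtain ⟨hint, heq⟩ := integral_realizedRegret_predictions hXne hXcomp hRcont hRconv η D l
  rw [heq]
  refine (integral_mono hint ((integrable_const _).add hwidth) fun z =>
    realizedRegret_regArgmin_le hXne hXcomp hXconv hRcont hUopen hXU hRsmooth hRhess l hl hη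
      z).trans_eq ?_
  simp only [Pi.add_apply]
  rw [integral_add (integrable_const _) hwidth, integral_const, probReal_univ, one_smul]

/-! ### The degenerate cases of the tuned learning rate -/

theorem regRange_nonneg (hXne : X.Nonempty) (hXcomp : IsCompact X) (hRcont : ContinuousOn R X) :
    0 ≤ regRange X R := by
  obtain ⟨u, hu⟩ := hXne
  simpa using sub_le_regRange hXcomp hRcont hu hu

theorem sumSqDual_nonneg (R : EuclideanSpace ℝ (Fin N) → ℝ) (V : Set (EuclideanSpace ℝ (Fin N)))
    (l : Fin T → EuclideanSpace ℝ (Fin N)) : 0 ≤ sumSqDual R V l := by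
  refine Finset.sum_nonneg fun t _ => Real.sSup_nonneg ?_
  rintro _ ⟨x, _, rfl⟩
  positivity

/-- A constant regularizer is minimised everywhere, while strict convexity permits one minimiser. -/
theorem subsingleton_of_regRange_eq_zero (hXcomp : IsCompact X) (hRcont : ContinuousOn R X)
    (hRconv : StrictConvexOn ℝ X R) (h : regRange X R = 0) : X.Subsingleton := by
  have hle : ∀ u ∈ X, ∀ v ∈ X, R u ≤ R v := fun u hu v hv => by
    linarith [sub_le_regRange hXcomp hRcont hu hv]
  exact fun u hu v hv => hRconv.eq_of_isMinOn (fun w hw => hle u hu w hw)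
    (fun w hw => hle v hv w hw) hu hv

theorem eq_zero_of_sumSqDual_eq_zero (hXne : X.Nonempty) (hXconv : Convex ℝ X)
    (hXU : intrinsicInterior ℝ X ⊆ U)
    (hRhess : ∀ x ∈ X ∩ U, ∀ y, y ≠ 0 → 0 < fderiv ℝ (fderiv ℝ R) x y y)
    {l : Fin T → EuclideanSpace ℝ (Fin N)}
    (hl : ∀ t, BddAbove ((fun x => dualHessNorm R x (l t) ^ 2) '' (X ∩ U)))
    (h : sumSqDual R (X ∩ U) l = 0) (t : Fin T) : l t = 0 := by
  have h1 := (Finset.sum_eq_zero_iff_of_nonneg (fun t _ => Real.sSup_nonneg (by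
    rintro _ ⟨x, _, rfl⟩
    positivity))).mp h t (Finset.mem_univ t)
  have h2 := inner_eq_zero_of_dualHessNorm_sq_le_zero hXne hXconv hXU hRhess
    (fun x hx => (le_csSup (hl t) ⟨x, hx, rfl⟩).trans h1.le) (l t)
  exact inner_self_eq_zero.mp h2

theorem realizedRegret_eq_zero_of_subsingleton (hX : X.Subsingleton)
    (l : Fin T → EuclideanSpace ℝ (Fin N)) {x : Fin T → EuclideanSpace ℝ (Fin N)}
    (hXne : X.Nonempty) (hx : ∀ t, x t ∈ X) : realizedRegret X l x = 0 := by
  obtain ⟨a, ha⟩ := hXne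
  obtain rfl := hX.eq_singleton_of_mem ha
  have hxa : ∀ t, x t = a := hx
  simp [realizedRegret, hxa]

theorem realizedRegret_eq_zero_of_eq_zero (hXne : X.Nonempty)
    {l : Fin T → EuclideanSpace ℝ (Fin N)} (hl : ∀ t, l t = 0)
    (x : Fin T → EuclideanSpace ℝ (Fin N)) : realizedRegret X l x = 0 := by
  simp [realizedRegret, hl, hXne.image_const]

/-- The rate √(2A / B) balances the two terms A / η and ηB / 2. -/
theorem div_add_div_two_mul_eq_sqrt {A B : ℝ} (hA : 0 < A) (hB : 0 < B) :
    A / √(2 * A / B) + √(2 * A / B) / 2 * B = √(2 * A * B) := by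
  have h2 : √(2 * A * B) = B * √(2 * A / B) := by
    rw [show 2 * A * B = B ^ 2 * (2 * A / B) by field_simp, Real.sqrt_mul (sq_nonneg B),
      Real.sqrt_sq hB.le]
  have h3 : 0 < √(2 * A / B) := Real.sqrt_pos.mpr (by positivity)
  have h4 : √(2 * A / B) ^ 2 * B = 2 * A := by
    rw [Real.sq_sqrt (by positivity)]
    field_simp
  rw [h2]
  have h5 : A / √(2 * A / B) = √(2 * A / B) / 2 * B := by
    rw [div_eq_iff h3.ne']
    linarith
  rw [h5]
  ring

end DPFTRL

end

/-! ### Privacy and regret combined -/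

theorem theorem3p1 {N T : ℕ}
    (X Y U : Set (EuclideanSpace ℝ (Fin N)))
    (hXne : X.Nonempty) (hXcomp : IsCompact X) (hXconv : Convex ℝ X)
    (hY : BddAbove ((fun l => ∑ i, |l i|) '' Y))
    (R : EuclideanSpace ℝ (Fin N) → ℝ)
    (hRcont : ContinuousOn R X) (hRconv : StrictConvexOn ℝ X R)
    (hUopen : IsOpen U) (hXU : intrinsicInterior ℝ X ⊆ U)
    (hRsmooth : ContDiffOn ℝ 2 R U)
    (hRhess : ∀ x ∈ X ∩ U, ∀ y, y ≠ 0 → 0 < fderiv ℝ (fderiv ℝ R) x y y)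
    (ε lam : ℝ) (hε : 0 < ε) (hlam : lam = 2 * l1Radius Y * (depth T : ℝ) / ε) :
    -- privacy, for every learning rate
    (∀ η : ℝ, 0 < η →
      IsDifferentiallyPrivate (noiseLaw T (laplaceVec N lam)) (predictions X R η) Y ε 0) ∧
    -- the expectation in the definition of the noise term exists
    Integrable (width X) (sumLaw (depth T) (laplaceVec N lam)) ∧
    -- regret
    (∀ l : Fin T → EuclideanSpace ℝ (Fin N), (∀ t, l t ∈ Y) →
      (∀ t, BddAbove ((fun x => dualHessNorm R x (l t) ^ 2) '' (X ∩ U))) →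
      ∀ η : ℝ, 0 < η →
        Integrable (fun ω => realizedRegret X l (predictions X R η l ω))
          (noiseLaw T (laplaceVec N lam)) ∧
        ∫ ω, realizedRegret X l (predictions X R η l ω) ∂(noiseLaw T (laplaceVec N lam)) ≤
          regRange X R / η + η / 2 * sumSqDual R (X ∩ U) l +
            ∫ z, width X z ∂(sumLaw (depth T) (laplaceVec N lam)) ∧
        ((regRange X R * sumSqDual R (X ∩ U) l ≠ 0 →
            η = √(2 * regRange X R / sumSqDual R (X ∩ U) l)) →
          ∫ ω, realizedRegret X l (predictions X R η l ω) ∂(noiseLaw T (laplaceVec N lam)) ≤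
            √(2 * regRange X R * sumSqDual R (X ∩ U) l) +
              ∫ z, width X z ∂(sumLaw (depth T) (laplaceVec N lam)))) := by
  have hlam0 : 0 ≤ lam := by
    have := l1Radius_nonneg Y
    rw [hlam]
    positivity
  have hprob := isProbabilityMeasure_laplaceVec (N := N) hlam0
  have hwidth : Integrable (width X) (sumLaw (depth T) (laplaceVec N lam)) :=
    integrable_width hXne hXcomp _ (integrable_norm_sumLaw _ _ (integrable_norm_laplaceVec hlam0))
  refine ⟨fun η _ => isDifferentiallyPrivate_predictions hY R η hε hlam, hwidth,
    fun l _ hl η hη => ?_⟩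
  have hbound := integral_realizedRegret_le hXne hXcomp hXconv hRcont hRconv hUopen hXU hRsmooth
    hRhess (laplaceVec N lam) hwidth l hl hη
  refine ⟨integrable_realizedRegret hXne hXcomp hRcont hRconv η _ l, hbound, fun htuned => ?_⟩
  -- Here balancing gives no valid positive rate, but `X` is a single point or all losses vanish, so
  -- the regret is zero for any η.
  by_cases hdeg : regRange X R * sumSqDual R (X ∩ U) l = 0
  · have hzero : ∀ ω, realizedRegret X l (predictions X R η l ω) = 0 := by
      intro ω
      rcases mul_eq_zero.mp hdeg with h | h
      · exact realizedRegret_eq_zero_of_subsingleton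
          (subsingleton_of_regRange_eq_zero hXcomp hRcont hRconv h) l hXne
          fun t => (regArgmin_spec hXne hXcomp hRcont η _).1
      · exact realizedRegret_eq_zero_of_eq_zero hXne
          (eq_zero_of_sumSqDual_eq_zero hXne hXconv hXU hRhess hl h) _
    simp only [hzero, integral_zero]
    exact add_nonneg (Real.sqrt_nonneg _) (integral_nonneg fun z => width_nonneg hXne hXcomp z)
  · have hA : 0 < regRange X R := (regRange_nonneg hXne hXcomp hRcont).lt_of_ne'
      (left_ne_zero_of_mul hdeg)
    have hB : 0 < sumSqDual R (X ∩ U) l := (sumSqDual_nonneg R _ l).lt_of_ne'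
      (right_ne_zero_of_mul hdeg)
    rw [← div_add_div_two_mul_eq_sqrt hA hB, ← htuned hdeg]
    exact hbound
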